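/- **Setting.** For a finite nonnegative Borel measure $\mu$ on $\mathbb{R}$ write $\mu=\mu_{\mathrm{ac}}+\mu_{\mathrm{sing}}$ for its Lebesgue decomposition, $F(x)=\mu((-\infty,x))$, $F_{\mathrm{ac}}(x)=\mu_{\mathrm{ac}}((-\infty,x))$, $F_{\mathrm{sing}}=F-F_{\mathrm{ac}}$, $F_\infty=\mu(\mathbb{R})$, $F_{\mathrm{ac},\infty}=\mu_{\mathrm{ac}}(\mathbb{R})$. Let $\chi^\pm\in C^\infty(\mathbb{R})$, $0\le\chi^\pm\le1$, $\chi^++\chi^-=1$, $\operatorname{supp}\chi^+\subset(-1,\infty)$, $\operatorname{supp}\chi^-\subset(-\infty,1)$. The set $\mathcal{D}$ consists of all pairs $(u,\mu)$ such that $u=h+a\chi^++b\chi^-$ for some $h\in H^1(\mathbb{R})$ (continuous representative), $a,b\in\mathbb{R}$; $\mu$ is a finite nonnegative Borel measure; $F-c\chi^+\in L^2(\mathbb{R})$ for some $c\in\mathbb{R}$; and $d\mu_{\mathrm{ac}}=u_x^2\,dx$. *The maps.* $L((u,\mu))=(y,U,V)$ with $y(\xi)=\sup\{x: x+\mu((-\infty,x))<\xi\}$,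 $U=u\circ y$, $V(\xi)=\xi-y(\xi)$. In the conservative case $\alpha=0$, $S_t(\bar y,\bar U,\bar V)=(y,U,V)(t)$, $t\ge 0$, is the solution of $$y_t=U,\qquad U_t=\tfrac12V-\tfrac14V_\infty(t),\qquad V(t,\xi)=\int_{-\infty}^{\xi}\bar V_\xi(\eta)\,d\eta,\qquad V_\infty(t)=\lim_{\xi\to\infty}V(t,\xi),$$ with initial value $(\bar y,\bar U,\bar V)$. $M((y,U,V))=(u,\mu)$ with $u(x)=U(\xi)$ for any $\xi$ such that $y(\xi)=x$, and $\mu=y_{\#}(V_\xi\,d\xi)$. Finally $T_t=M\circ S_t\circ L$. *The projection.* Let $\Delta x>0$, $x_k=k\Delta x$, $f_k=f(x_k)$, $Df_{2j}=\frac{f_{2j+2}-f_{2j}}{2\Delta x}$, $q_{2j}=\sqrt{DF_{\mathrm{ac},2j}-(Du_{2j})^2}$, and fix a sign $s_j\in\{-1,1\}$ for every $j\in\mathbb{Z}$. Then $P_{\Delta x}((u,\mu))=(u_{\Delta x},\mu_{\Delta x})$, where $$u_{\Delta x}(x)=\begin{cases}u_{2j}+(Du_{2j}-s_jq_{2j})(x-x_{2j}),&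 x_{2j}<x\le x_{2j+1},\\ u_{2j+2}+(Du_{2j}+s_jq_{2j})(x-x_{2j+2}),& x_{2j+1}<x\le x_{2j+2},\end{cases}$$ and $\mu_{\Delta x}$ is the finite measure with cumulative function $\mu_{\Delta x}((-\infty,x))=F_{\Delta x,\mathrm{ac}}(x)+F_{\Delta x,\mathrm{sing}}(x)$, where $F_{\Delta x,\mathrm{sing}}(x)=F_{\mathrm{sing},2j+2}$ for $x_{2j}<x\le x_{2j+2}$ and $$F_{\Delta x,\mathrm{ac}}(x)=\begin{cases}F_{\mathrm{ac},2j}+(Du_{2j}-s_jq_{2j})^2(x-x_{2j}),& x_{2j}<x\le x_{2j+1},\\ \tfrac12(F_{\mathrm{ac},2j+2}+F_{\mathrm{ac},2j})-2s_jq_{2j}Du_{2j}\Delta x+(Du_{2j}+s_jq_{2j})^2(x-x_{2j+1}),& x_{2j+1}<x\le x_{2j+2}.\end{cases}$$ **Lemma.** Let $\alpha=0$, $(\bar u,\bar\mu)\in\mathcal{D}$, with $\bar F_\infty=\bar\mu(\mathbb{R})$ and $\bar F_{\mathrm{ac},\infty}=\bar\mu_{\mathrm{ac}}(\mathbb{R})$,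 let $\Delta x>0$, let the signs $(s_j)$ be arbitrary, and let $t\in[0,\infty)$. Put $(y,U,V)(t)=S_t\circ L((\bar u,\bar\mu))$ and $(y_{\Delta x},U_{\Delta x},V_{\Delta x})(t)=S_t\circ L\circ P_{\Delta x}((\bar u,\bar\mu))$. Then $$\|U(t)-U_{\Delta x}(t)\|_\infty\le(1+2\sqrt2)\,\bar F_{\mathrm{ac},\infty}^{1/2}\Delta x^{1/2}+t\Delta x,$$ $$\|y(t)-y_{\Delta x}(t)\|_\infty\le(1+2\sqrt2)\,\bar F_{\mathrm{ac},\infty}^{1/2}\,t\,\Delta x^{1/2}+\bigl(2+\tfrac12t^2\bigr)\Delta x.$$ Furthermore, if $(u,\mu)(t)=T_t((\bar u,\bar\mu))$ and $(u_{\Delta x},\mu_{\Delta x})(t)=T_t\circ P_{\Delta x}((\bar u,\bar\mu))$, then $$\|u(t)-u_{\Delta x}(t)\|_\infty\le\sqrt{1+2\sqrt2}\;\bar F_\infty^{3/4}t^{1/2}\Delta x^{1/4}+\Bigl(1+2\sqrt2+\sqrt{2+\tfrac12t^2}\Bigr)\bar F_\infty^{1/2}\Delta x^{1/2}+t\Delta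 x.$$ Here $\|f\|_\infty$ is the supremum of $|f|$ over $\mathbb{R}$. -/

import Mathlib

open MeasureTheory Set Filter Topology
open scoped ENNReal ContDiff

noncomputable section

namespace HunterSaxton

/-! Function spaces on the real line. Elements of `H¹` are represented by their continuous
representative, since they are evaluated pointwise. -/

/-- `g` is the weak (distributional) derivative of `f` on `ℝ`. -/
structure HasWeakDeriv (f g : ℝ → ℝ) : Prop where
  locallyIntegrable : LocallyIntegrable f volume
  locallyIntegrable_deriv : LocallyIntegrable g volume
  integral_eq : ∀ φ : ℝ → ℝ, ContDiff ℝ ∞ φ → HasCompactSupport φ →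
    ∫ x, f x * deriv φ x = -∫ x, g x * φ x

/-- `f` is (the continuous representative of) an element of `H¹(ℝ)`. -/
def MemH1 (f : ℝ → ℝ) : Prop :=
  Continuous f ∧ MemLp f 2 volume ∧ ∃ g : ℝ → ℝ, MemLp g 2 volume ∧ HasWeakDeriv f g

/-- A smooth partition of unity subordinate to `ℝ = (-1, ∞) ∪ (-∞, 1)`. -/
structure IsPartition (χp χm : ℝ → ℝ) : Prop where
  smooth_p : ContDiff ℝ ∞ χp
  smooth_m : ContDiff ℝ ∞ χm
  add_eq_one : ∀ x, χp x + χm x = 1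
  p_mem : ∀ x, χp x ∈ Icc (0 : ℝ) 1
  m_mem : ∀ x, χm x ∈ Icc (0 : ℝ) 1
  tsupport_p : tsupport χp ⊆ Ioi (-1)
  tsupport_m : tsupport χm ⊆ Iio 1

/-- `E₂`: the functions `h + a χ⁺ + b χ⁻` with `h ∈ H¹(ℝ)` and `a b : ℝ`.
The space does not depend on the partition of unity. -/
def MemE2 (f : ℝ → ℝ) : Prop :=
  ∃ χp χm : ℝ → ℝ, IsPartition χp χm ∧
    ∃ a b : ℝ, MemH1 (fun x => f x - a * χp x - b * χm x)

/-- `E₁⁰`: the functions `h + a χ⁺` with `h ∈ L²(ℝ)` and `a : ℝ`. -/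
def MemE10 (f : ℝ → ℝ) : Prop :=
  ∃ χp χm : ℝ → ℝ, IsPartition χp χm ∧ ∃ a : ℝ, MemLp (fun x => f x - a * χp x) 2 volume

/-! Eulerian coordinates. -/

/-- A wave profile together with an energy measure. -/
structure Euler where
  u : ℝ → ℝ
  μ : Measure ℝ

/-- Absolutely continuous part of a measure, with respect to Lebesgue measure. -/
def acPart (μ : Measure ℝ) : Measure ℝ := volume.withDensity (μ.rnDeriv volume)

/-- Cumulative function `F(x) = μ((-∞, x))`. -/
def cum (μ : Measure ℝ) (x : ℝ) : ℝ := μ.real (Iio x)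

/-- The set `𝒟` of admissible Eulerian data. -/
structure MemD (Z : Euler) : Prop where
  u_mem : MemE2 Z.u
  finite : IsFiniteMeasure Z.μ
  cum_mem : MemE10 (cum Z.μ)
  ac_eq : ∃ ux : ℝ → ℝ, HasWeakDeriv Z.u ux ∧
    acPart Z.μ = volume.withDensity (fun x => ENNReal.ofReal (ux x ^ 2))

open Classical in
/-- The (unique) finite measure with cumulative function `F`. -/
def measureOfCum (F : ℝ → ℝ) : Measure ℝ :=
  if h : ∃ ν : Measure ℝ, IsFiniteMeasure ν ∧ ∀ x, cum ν x = F x then h.choose else 0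

/-! The projection operator. The mesh is `x_k = k Δx`. The choice of sign in the cell
`(x_{2j}, x_{2j+2}]` is `s j = ±1`: the upper signs in `∓`, `±` correspond to `s j = 1`. -/

/-- The index `j` with `x_{2j} < x ≤ x_{2j+2}`. -/
def cell (Δx x : ℝ) : ℤ := ⌈x / (2 * Δx)⌉ - 1

/-- The grid point `x_k`. -/
def grid (Δx : ℝ) (k : ℤ) : ℝ := k * Δx

/-- The difference operator `D f_{2j}`. -/
def diffOp (Δx : ℝ) (f : ℝ → ℝ) (j : ℤ) : ℝ :=
  (f (grid Δx (2 * j + 2)) - f (grid Δx (2 * j))) / (2 * Δx)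

/-- The quantity `q_{2j}`. -/
def q (Δx : ℝ) (Z : Euler) (j : ℤ) : ℝ :=
  Real.sqrt (diffOp Δx (cum (acPart Z.μ)) j - diffOp Δx Z.u j ^ 2)

/-- The projected wave profile. -/
def projU (Δx : ℝ) (s : ℤ → ℤˣ) (Z : Euler) (x : ℝ) : ℝ :=
  let j := cell Δx x
  let σ : ℝ := ((s j : ℤ) : ℝ)
  if x ≤ grid Δx (2 * j + 1) then
    Z.u (grid Δx (2 * j)) + (diffOp Δx Z.u j - σ * q Δx Z j) * (x - grid Δx (2 * j))
  else
    Z.u (grid Δx (2 * j + 2)) + (diffOp Δx Z.u j + σ * q Δx Z j) * (x - grid Δx (2 * j + 2))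

/-- The absolutely continuous part of the projected cumulative energy. -/
def projFac (Δx : ℝ) (s : ℤ → ℤˣ) (Z : Euler) (x : ℝ) : ℝ :=
  let j := cell Δx x
  let σ : ℝ := ((s j : ℤ) : ℝ)
  let Fac := cum (acPart Z.μ)
  if x ≤ grid Δx (2 * j + 1) then
    Fac (grid Δx (2 * j)) + (diffOp Δx Z.u j - σ * q Δx Z j) ^ 2 * (x - grid Δx (2 * j))
  else
    (1 / 2) * (Fac (grid Δx (2 * j + 2)) + Fac (grid Δx (2 * j)))
      - σ * (2 * q Δx Z j * diffOp Δx Z.u j * Δx)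
      + (diffOp Δx Z.u j + σ * q Δx Z j) ^ 2 * (x - grid Δx (2 * j + 1))

/-- The singular part of the projected cumulative energy. -/
def projFsing (Δx : ℝ) (Z : Euler) (x : ℝ) : ℝ :=
  cum (Z.μ.singularPart volume) (grid Δx (2 * cell Δx x + 2))

/-- The projection operator `P_Δx`. -/
def P (Δx : ℝ) (s : ℤ → ℤˣ) (Z : Euler) : Euler where
  u := projU Δx s Z
  μ := measureOfCum (fun x => projFac Δx s Z x + projFsing Δx Z x)

/-! Lagrangian coordinates. -/

/-- Characteristics, velocity and cumulative energy in Lagrangian coordinates. -/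
structure Lagrange where
  y : ℝ → ℝ
  U : ℝ → ℝ
  V : ℝ → ℝ

/-- The map from Eulerian to Lagrangian coordinates. -/
def L (Z : Euler) : Lagrange where
  y := fun ξ => sSup {x : ℝ | x + cum Z.μ x < ξ}
  U := fun ξ => Z.u (sSup {x : ℝ | x + cum Z.μ x < ξ})
  V := fun ξ => ξ - sSup {x : ℝ | x + cum Z.μ x < ξ}

open Classical in
/-- The wave breaking function. -/
def waveBreaking (X : Lagrange) (ξ : ℝ) : ℝ≥0∞ :=
  if deriv X.U ξ = 0 ∧ deriv X.y ξ = 0 then 0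
  else if deriv X.U ξ < 0 then ENNReal.ofReal (-2 * deriv X.y ξ / deriv X.U ξ)
  else ⊤

open Classical in
/-- The energy density `V_ξ(t, ·)`: an `α`-fraction is removed at each positive breaking time. -/
def energyDensity (α : ℝ) (X₀ : Lagrange) (t η : ℝ) : ℝ :=
  (1 - α * (if 0 < waveBreaking X₀ η ∧ waveBreaking X₀ η ≤ ENNReal.ofReal t then 1 else 0))
    * deriv X₀.V η

/-- `X` is the `α`-dissipative solution of the Lagrangian system
`y_t = U`, `U_t = V / 2 - V_∞ / 4`, `V = ∫_{-∞}^ξ V_ξ(t, η) dη` with `X(0) = X₀`.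
The right-hand side may jump in time, so the differential equations are integrated in time. -/
structure IsLagrangianSolution (α : ℝ) (X₀ : Lagrange) (X : ℝ → Lagrange) : Prop where
  initial : X 0 = X₀
  integrable : ∀ t, 0 ≤ t → Integrable (energyDensity α X₀ t) volume
  V_eq : ∀ t, 0 ≤ t → ∀ ξ, (X t).V ξ = ∫ η in Iic ξ, energyDensity α X₀ t η
  U_eq : ∃ Vinf : ℝ → ℝ, (∀ t, 0 ≤ t → Tendsto (X t).V atTop (𝓝 (Vinf t))) ∧
    ∀ t, 0 ≤ t → ∀ ξ,
      IntervalIntegrable (fun r => (1 / 2) * (X r).V ξ - (1 / 4) * Vinf r) volume 0 t ∧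
      (X t).U ξ = X₀.U ξ + ∫ r in (0 : ℝ)..t, ((1 / 2) * (X r).V ξ - (1 / 4) * Vinf r)
  y_eq : ∀ t, 0 ≤ t → ∀ ξ, IntervalIntegrable (fun r => (X r).U ξ) volume 0 t ∧
    (X t).y ξ = X₀.y ξ + ∫ r in (0 : ℝ)..t, (X r).U ξ

open Classical in
/-- The Lagrangian solution operator `S_t`, for `t ≥ 0`. -/
def S (α t : ℝ) (X₀ : Lagrange) : Lagrange :=
  if h : ∃ X : ℝ → Lagrange, IsLagrangianSolution α X₀ X then h.choose t else X₀

/-- The map from Lagrangian to Eulerian coordinates: `u(x) = U(ξ)` for any `ξ` with `y(ξ) = x`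
(`Function.invFun` selects such a `ξ`), and `μ` is the push-forward of `V_ξ dξ` under `y`. -/
def M (X : Lagrange) : Euler where
  u := fun x => X.U (Function.invFun X.y x)
  μ := Measure.map X.y (volume.withDensity (fun ξ => ENNReal.ofReal (deriv X.V ξ)))

/-- The Eulerian solution operator `T_t = M ∘ S_t ∘ L`. -/
def T (α t : ℝ) (Z : Euler) : Euler := M (S α t (L Z))

end HunterSaxton

end

/-! For `α = 0` the energy `V` is frozen in time, so the Lagrangian flow is explicit and polynomial
in `t` (`freeFlow`, `LagData.S_eq_freeFlow`). The projection keeps the total mass `m`, hence the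
`V_∞` terms cancel in differences: the error in `U(t)` is that of `U + (t/2) V` at time zero, and
the error in `y(t)` that of `y + t U + (t²/4) V`.

At time zero, the projection reproduces `u` and `F` at the even grid points, so both initial
characteristics lie in one closed cell of length `2Δx` (`exists_common_cell`). This bounds the error
of `y` by `2Δx`, and that of `V` too, because `y + V = id`. For `U`, both profiles satisfy `(δu)² ≤
δx · δA`, where `A` is the continuous part of the energy. Comparing each with the shared value at
the left node of the cell gives `2√(2Δx F_ac,∞)`.

The Eulerian estimate rests on `(δU)² ≤ δy · δV`. The flow leaves `δy · δV - (δU)²` unchanged, so at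
every time `y` is monotone and `U` is 1/2-Hölder as a function of `y` with constant `√m`. This gives
`|u - u'| ≤ √(m ‖y - y'‖) + ‖U - U'‖` (`LagData.abs_M_u_sub_le`), and subadditivity of the square
root finishes the proof.

Data and projection are treated alike: both satisfy `CumData`, which implies `LagData`. -/

namespace HunterSaxton

/-! ### Weak derivatives: fundamental theorem of calculus and Cauchy–Schwarz -/

lemma deriv_smoothTransition_of_notMem {z : ℝ} (hz : z ∉ Icc (0 : ℝ) 1) :
    deriv Real.smoothTransition z = 0 := by
  have hz' : z < 0 ∨ 1 < z := by
    by_contra! h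
    exact hz h
  rcases hz' with h | h
  · have : Real.smoothTransition =ᶠ[𝓝 z] fun _ => 0 := by
      filter_upwards [Iio_mem_nhds h] with w hw
      exact Real.smoothTransition.zero_of_nonpos (le_of_lt hw)
    rw [this.deriv_eq]; simp
  · have : Real.smoothTransition =ᶠ[𝓝 z] fun _ => 1 := by
      filter_upwards [Ioi_mem_nhds h] with w hw
      exact Real.smoothTransition.one_of_one_le (le_of_lt hw)
    rw [this.deriv_eq]; simp

lemma contDiff_smoothTransition : ContDiff ℝ ∞ Real.smoothTransition :=
  Real.smoothTransition.contDiff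

lemma continuous_deriv_smoothTransition : Continuous (deriv Real.smoothTransition) :=
  contDiff_smoothTransition.continuous_deriv (by simp)

/-- The smoothed step at `a` of width `1 / n`. -/
noncomputable def smoothStep (a n x : ℝ) : ℝ := Real.smoothTransition (n * (x - a))

lemma contDiff_smoothStep (a n : ℝ) : ContDiff ℝ ∞ (smoothStep a n) :=
  contDiff_smoothTransition.comp (contDiff_const.mul (contDiff_id.sub contDiff_const))

lemma deriv_smoothStep (a n x : ℝ) :
    deriv (smoothStep a n) x = n * deriv Real.smoothTransition (n * (x - a)) := by
  have h1 : HasDerivAt (fun x : ℝ => n * (x - a)) n x := by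
    simpa using ((hasDerivAt_id x).sub_const a).const_mul n
  have h2 := (contDiff_smoothTransition.differentiable (by simp) (n * (x - a))).hasDerivAt
  have := (h2.comp x h1).deriv
  rw [mul_comm]
  exact this

lemma integral_mul_deriv_smoothStep (f : ℝ → ℝ) (a : ℝ) {n : ℝ} (hn : 0 < n) :
    ∫ x, f x * deriv (smoothStep a n) x
      = ∫ z in (0 : ℝ)..1, f (a + n⁻¹ * z) * deriv Real.smoothTransition z := by
  have h1 := integral_sub_right_eq_self (μ := (volume : Measure ℝ))
    (fun x => f (a + x) * (n * deriv Real.smoothTransition (n * x))) a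
  have h2 := Measure.integral_comp_mul_left
    (fun z => f (a + n⁻¹ * z) * (n * deriv Real.smoothTransition z)) n
  calc ∫ x, f x * deriv (smoothStep a n) x
      = ∫ x, f (a + x) * (n * deriv Real.smoothTransition (n * x)) := by
        rw [← h1]; simp [deriv_smoothStep]
    _ = ∫ x, f (a + n⁻¹ * (n * x)) * (n * deriv Real.smoothTransition (n * x)) := by
        simp [hn.ne']
    _ = n⁻¹ * ∫ z, f (a + n⁻¹ * z) * (n * deriv Real.smoothTransition z) := by
        rw [h2, abs_of_pos (inv_pos.2 hn), smul_eq_mul]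
    _ = ∫ z, f (a + n⁻¹ * z) * deriv Real.smoothTransition z := by
        rw [← integral_const_mul]
        congr 1; ext z; field_simp
    _ = ∫ z in Icc (0 : ℝ) 1, f (a + n⁻¹ * z) * deriv Real.smoothTransition z := by
        rw [setIntegral_eq_integral_of_forall_compl_eq_zero]
        intro z hz
        rw [deriv_smoothTransition_of_notMem hz, mul_zero]
    _ = _ := by
        rw [intervalIntegral.integral_of_le zero_le_one, integral_Icc_eq_integral_Ioc]

/-- The derivative of the step is an approximate identity at `a`. After rescaling, the integral is a
continuous function of the width `h = 1/(n+1)`, and its value at `h = 0` is `f a`. -/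
lemma tendsto_integral_mul_deriv_smoothStep {f : ℝ → ℝ} (hf : Continuous f) (a : ℝ) :
    Tendsto (fun n : ℕ => ∫ x, f x * deriv (smoothStep a (n + 1)) x) atTop (𝓝 (f a)) := by
  have hc : Continuous fun h : ℝ =>
      ∫ z in (0 : ℝ)..1, f (a + h * z) * deriv Real.smoothTransition z := by
    apply intervalIntegral.continuous_parametric_intervalIntegral_of_continuous'
    have := continuous_deriv_smoothTransition
    simp only [Function.uncurry_def]
    fun_prop
  have h0 : ∫ z in (0 : ℝ)..1, f (a + 0 * z) * deriv Real.smoothTransition z = f a := by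
    simp only [zero_mul, add_zero, intervalIntegral.integral_const_mul]
    rw [intervalIntegral.integral_deriv_eq_sub]
    · simp
    · intro x _
      exact contDiff_smoothTransition.differentiable (by simp) x
    · exact continuous_deriv_smoothTransition.intervalIntegrable _ _
  have hlim : Tendsto (fun n : ℕ => ((n : ℝ) + 1)⁻¹) atTop (𝓝 0) := by
    simpa using tendsto_one_div_add_atTop_nhds_zero_nat (𝕜 := ℝ)
  have := (hc.tendsto 0).comp hlim
  rw [h0] at this
  refine this.congr fun n => ?_
  rw [integral_mul_deriv_smoothStep f a (by positivity)]
  rfl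

lemma tendsto_smoothStep (a x : ℝ) :
    Tendsto (fun n : ℕ => smoothStep a (n + 1) x) atTop (𝓝 ((Ioi a).indicator 1 x)) := by
  by_cases hx : a < x
  · rw [indicator_of_mem (mem_Ioi.2 hx)]
    refine tendsto_const_nhds.congr' ?_
    obtain ⟨N, hN⟩ := exists_nat_gt (1 / (x - a))
    filter_upwards [eventually_ge_atTop N] with n hn
    symm
    apply Real.smoothTransition.one_of_one_le
    have h1 : (0 : ℝ) < x - a := by linarith
    have h2 : (N : ℝ) ≤ n := by exact_mod_cast hn
    rw [div_lt_iff₀ h1] at hN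
    nlinarith
  · rw [indicator_of_notMem (by simpa using hx)]
    refine tendsto_const_nhds.congr fun n => ?_
    symm
    apply Real.smoothTransition.zero_of_nonpos
    have : x - a ≤ 0 := by linarith
    have : (0 : ℝ) < (n : ℝ) + 1 := by positivity
    nlinarith

/-- A continuous function with a weak derivative is the integral of that derivative. -/
lemma HasWeakDeriv.sub_eq_integral {f g : ℝ → ℝ} (h : HasWeakDeriv f g) (hf : Continuous f)
    {a b : ℝ} (hab : a ≤ b) : f b - f a = ∫ x in a..b, g x := by
  -- These test functions tend to the indicator of `(a, b]`, while their derivatives tend to a unit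
  -- mass at `a` minus one at `b`.
  set φ : ℕ → ℝ → ℝ := fun n x => smoothStep a (n + 1) x - smoothStep b (n + 1) x with hφ
  have hsupp : ∀ n : ℕ, ∀ x, x ∉ Icc a (b + 1) → φ n x = 0 := by
    intro n x hx
    have hn : (0 : ℝ) ≤ n := by positivity
    have hx' : x < a ∨ b + 1 < x := by
      by_contra! h
      exact hx h
    rcases hx' with h | h
    · simp only [hφ, smoothStep]
      rw [Real.smoothTransition.zero_of_nonpos (by nlinarith),
        Real.smoothTransition.zero_of_nonpos (by nlinarith), sub_zero]
    · simp only [hφ, smoothStep]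
      rw [Real.smoothTransition.one_of_one_le (by nlinarith),
        Real.smoothTransition.one_of_one_le (by nlinarith), sub_self]
  have hcs : ∀ n, HasCompactSupport (φ n) := fun n =>
    HasCompactSupport.of_support_subset_isCompact (isCompact_Icc (a := a) (b := b + 1)) (by
      intro x hx
      by_contra hx'
      exact hx (hsupp n x hx'))
  have hsm : ∀ n, ContDiff ℝ ∞ (φ n) := fun n =>
    (contDiff_smoothStep a _).sub (contDiff_smoothStep b _)
  have hint : ∀ (c : ℝ) (n : ℕ), Integrable (fun x => f x * deriv (smoothStep c (n + 1)) x) := by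
    intro c n
    have hcont : Continuous (deriv (smoothStep c (n + 1))) :=
      (contDiff_smoothStep c _).continuous_deriv (by simp)
    apply (hf.mul hcont).integrable_of_hasCompactSupport
    apply HasCompactSupport.of_support_subset_isCompact (isCompact_Icc (a := c) (b := c + 1))
    intro x hx
    by_contra hx'
    apply hx
    simp only [Pi.mul_apply]
    rw [deriv_smoothStep, deriv_smoothTransition_of_notMem, mul_zero, mul_zero]
    intro hm
    have hn : (0 : ℝ) ≤ n := by positivity
    apply hx'
    constructor <;> nlinarith [hm.1, hm.2]
  have hL : Tendsto (fun n => ∫ x, f x * deriv (φ n) x) atTop (𝓝 (f a - f b)) := by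
    refine ((tendsto_integral_mul_deriv_smoothStep hf a).sub
      (tendsto_integral_mul_deriv_smoothStep hf b)).congr fun n => ?_
    rw [← integral_sub (hint a n) (hint b n)]
    congr 1; ext x
    have : deriv (φ n) x = deriv (smoothStep a (n + 1)) x - deriv (smoothStep b (n + 1)) x :=
      deriv_sub ((contDiff_smoothStep a _).differentiable (by simp) x)
        ((contDiff_smoothStep b _).differentiable (by simp) x)
    rw [this]; ring
  have hgI : IntegrableOn g (Icc a (b + 1)) :=
    h.locallyIntegrable_deriv.integrableOn_isCompact isCompact_Icc
  have hR : Tendsto (fun n => ∫ x, g x * φ n x) atTop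
      (𝓝 (∫ x, g x * ((Ioi a).indicator 1 x - (Ioi b).indicator 1 x))) := by
    apply tendsto_integral_of_dominated_convergence
      (fun x => (Icc a (b + 1)).indicator (fun x => ‖g x‖) x)
    · intro n
      exact h.locallyIntegrable_deriv.aestronglyMeasurable.mul
        (hsm n).continuous.aestronglyMeasurable
    · exact (integrable_indicator_iff measurableSet_Icc).2 hgI.norm
    · intro n
      refine Eventually.of_forall fun x => ?_
      by_cases hx : x ∈ Icc a (b + 1)
      · rw [indicator_of_mem hx, norm_mul]
        refine mul_le_of_le_one_right (norm_nonneg _) ?_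
        rw [Real.norm_eq_abs, abs_le]
        simp only [hφ, smoothStep]
        have h1 := Real.smoothTransition.nonneg (((n : ℝ) + 1) * (x - a))
        have h2 := Real.smoothTransition.le_one (((n : ℝ) + 1) * (x - a))
        have h3 := Real.smoothTransition.nonneg (((n : ℝ) + 1) * (x - b))
        have h4 := Real.smoothTransition.le_one (((n : ℝ) + 1) * (x - b))
        constructor <;> linarith
      · rw [hsupp n x hx, indicator_of_notMem hx]; simp
    · refine Eventually.of_forall fun x => ?_
      exact ((tendsto_smoothStep a x).sub (tendsto_smoothStep b x)).const_mul _
  have hlim := tendsto_nhds_unique hL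
    ((hR.neg).congr fun n => (h.integral_eq (φ n) (hsm n) (hcs n)).symm)
  have hind : ∫ x, g x * ((Ioi a).indicator 1 x - (Ioi b).indicator 1 x) = ∫ x in a..b, g x := by
    rw [intervalIntegral.integral_of_le hab, ← integral_indicator measurableSet_Ioc]
    congr 1; ext x
    by_cases h1 : a < x <;> by_cases h2 : b < x
    · simp [indicator, h1, h2]
    · simp [indicator, h1, h2, not_lt.1 h2]
    · exact absurd (hab.trans_lt h2) h1
    · simp [indicator, h1, h2]
  rw [hind] at hlim
  linarith

/-- Cauchy–Schwarz for the increments of a function with locally square integrable derivative. -/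
lemma HasWeakDeriv.sq_sub_le {f g : ℝ → ℝ} (h : HasWeakDeriv f g) (hf : Continuous f)
    {ν : Measure ℝ} [IsFiniteMeasure ν]
    (hν : ν = volume.withDensity (fun x => ENNReal.ofReal (g x ^ 2)))
    {a b : ℝ} (hab : a < b) : (f b - f a) ^ 2 ≤ (b - a) * ν.real (Ioc a b) := by
  have hgm : AEStronglyMeasurable g volume := h.locallyIntegrable_deriv.aestronglyMeasurable
  have hg : IntegrableOn g (Ioc a b) :=
    (h.locallyIntegrable_deriv.integrableOn_isCompact isCompact_Icc).mono_set Ioc_subset_Icc_self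
  have hνI : ν (Ioc a b) = ∫⁻ x in Ioc a b, ENNReal.ofReal (g x ^ 2) := by
    rw [hν, withDensity_apply _ measurableSet_Ioc]
  have hg2 : IntegrableOn (fun x => g x ^ 2) (Ioc a b) := by
    refine ⟨(hgm.pow 2).restrict, ?_⟩
    rw [hasFiniteIntegral_iff_ofReal (Eventually.of_forall fun x => sq_nonneg _), ← hνI]
    exact measure_lt_top _ _
  have hreal : ν.real (Ioc a b) = ∫ x in Ioc a b, g x ^ 2 := by
    rw [Measure.real, hνI, integral_eq_lintegral_of_nonneg_ae
      (Eventually.of_forall fun x => sq_nonneg _) (hgm.pow 2).restrict]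
  have hI : f b - f a = ∫ x in Ioc a b, g x := by
    rw [h.sub_eq_integral hf hab.le, intervalIntegral.integral_of_le hab.le]
  -- Expansion of `∫ (g - c)² ≥ 0`; the choice `c = (f b - f a)/(b - a)` then gives Cauchy–Schwarz.
  have key : ∀ c : ℝ, 0 ≤ ν.real (Ioc a b) - 2 * c * (f b - f a) + c ^ 2 * (b - a) := by
    intro c
    have h0 : 0 ≤ ∫ x in Ioc a b, (g x - c) ^ 2 := integral_nonneg fun x => sq_nonneg _
    have h1 : ∫ x in Ioc a b, (g x - c) ^ 2
        = ∫ x in Ioc a b, ((g x ^ 2 - 2 * c * g x) + c ^ 2) := by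
      congr 1; ext x; ring
    have hc : IntegrableOn (fun x => 2 * c * g x) (Ioc a b) := hg.const_mul _
    have hd : IntegrableOn (fun x => g x ^ 2 - 2 * c * g x) (Ioc a b) := hg2.sub hc
    rw [h1, integral_add hd (integrableOn_const measure_Ioc_lt_top.ne), integral_sub hg2 hc, integral_const_mul, ← hI,
      ← hreal] at h0
    simp only [integral_const, MeasurableSet.univ, measureReal_restrict_apply, univ_inter,
      Real.volume_real_Ioc_of_le hab.le, smul_eq_mul] at h0
    linarith
  have hba : 0 < b - a := sub_pos.2 hab
  have := key ((f b - f a) / (b - a))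
  have h2 : ν.real (Ioc a b) - 2 * ((f b - f a) / (b - a)) * (f b - f a)
      + ((f b - f a) / (b - a)) ^ 2 * (b - a) = ν.real (Ioc a b) - (f b - f a) ^ 2 / (b - a) := by
    field_simp; ring
  rw [h2, sub_nonneg, div_le_iff₀ hba] at this
  linarith

/-! ### Cumulative functions of finite measures -/

lemma cum_mono (μ : Measure ℝ) [IsFiniteMeasure μ] : Monotone (cum μ) := fun _ _ h =>
  measureReal_mono (Iio_subset_Iio h)

lemma tendsto_cum_atTop (μ : Measure ℝ) [IsFiniteMeasure μ] :
    Tendsto (cum μ) atTop (𝓝 (μ.real univ)) := by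
  have h := tendsto_measure_iUnion_atTop (μ := μ) (s := fun x : ℝ => Iio x)
    (fun _ _ h => Iio_subset_Iio h)
  rw [iUnion_Iio] at h
  exact (ENNReal.tendsto_toReal (measure_ne_top _ _)).comp h

lemma tendsto_cum_atBot (μ : Measure ℝ) [IsFiniteMeasure μ] :
    Tendsto (cum μ) atBot (𝓝 0) := by
  have h := tendsto_measure_iInter_atBot (μ := μ) (s := fun x : ℝ => Iio x)
    (fun x => measurableSet_Iio.nullMeasurableSet)
    (fun _ _ h => Iio_subset_Iio h) ⟨0, measure_ne_top _ _⟩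
  have h0 : ⋂ x : ℝ, Iio x = ∅ := by
    ext x
    simp only [mem_iInter, mem_Iio, mem_empty_iff_false, iff_false, not_forall, not_lt]
    exact ⟨x, le_rfl⟩
  rw [h0] at h
  have := (ENNReal.tendsto_toReal (measure_ne_top μ ∅)).comp h
  rw [measure_empty, ENNReal.toReal_zero] at this
  exact this

lemma cum_nonneg (μ : Measure ℝ) (x : ℝ) : 0 ≤ cum μ x := measureReal_nonneg

lemma cum_le (μ : Measure ℝ) [IsFiniteMeasure μ] (x : ℝ) : cum μ x ≤ μ.real univ :=
  measureReal_mono (subset_univ _)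

lemma cum_sub_cum (μ : Measure ℝ) [IsFiniteMeasure μ] {a b : ℝ} (hab : a ≤ b) :
    cum μ b - cum μ a = μ.real (Ico a b) := by
  have h : Ico a b = Iio b \ Iio a := by
    ext x; simp
  rw [h, measureReal_sdiff (Iio_subset_Iio hab) measurableSet_Iio, cum, cum]

lemma cum_add (μ ν : Measure ℝ) [IsFiniteMeasure μ] [IsFiniteMeasure ν] (x : ℝ) :
    cum (μ + ν) x = cum μ x + cum ν x := measureReal_add_apply

/-- A monotone left-continuous function with limits at `±∞` and limit `0` at `-∞` is the
cumulative function of a finite measure. -/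
lemma exists_cum_eq {F : ℝ → ℝ} {m : ℝ} (hF : Monotone F)
    (hc : ∀ x, ContinuousWithinAt F (Iic x) x) (h0 : Tendsto F atBot (𝓝 0))
    (hm : Tendsto F atTop (𝓝 m)) :
    ∃ ν : Measure ℝ, IsFiniteMeasure ν ∧ ∀ x, cum ν x = F x := by
  have heq : (hF.stieltjesFunction : ℝ → ℝ) = Function.rightLim F :=
    funext hF.stieltjesFunction_eq
  have hb : Tendsto hF.stieltjesFunction atBot (𝓝 0) := by
    rw [heq]; exact tendsto_rightLim_atBot_of_tendsto h0
  have ht : Tendsto hF.stieltjesFunction atTop (𝓝 m) := by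
    rw [heq]; exact tendsto_rightLim_atTop_of_tendsto hm
  refine ⟨hF.stieltjesFunction.measure, hF.stieltjesFunction.isFiniteMeasure hb ht, fun x => ?_⟩
  -- The Stieltjes function is the right-continuous version of `F`. The mass of an open half-line
  -- sees its left limit, which is `F x` by left continuity.
  have hl : Function.leftLim hF.stieltjesFunction x = F x := by
    rw [heq, leftLim_rightLim (hF.tendsto_leftLim x), (hc x).leftLim_eq]
  rw [cum, Measure.real, StieltjesFunction.measure_Iio _ hb, hl, sub_zero,
    ENNReal.toReal_ofReal]
  exact hF.le_of_tendsto h0 x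

lemma cum_measureOfCum {F : ℝ → ℝ}
    (h : ∃ ν : Measure ℝ, IsFiniteMeasure ν ∧ ∀ x, cum ν x = F x) :
    cum (measureOfCum F) = F := by
  rw [measureOfCum, dif_pos h]
  exact funext h.choose_spec.2

/-! ### Eulerian data and the generalized inverse of `x + F(x)` -/

/-- Energy-constrained Eulerian data in terms of cumulative functions: a wave profile `u`, a
cumulative energy `F` of total mass `m`, and a continuous part `A` of `F` which controls the
increments of `u`. -/
structure CumData (u F A : ℝ → ℝ) (m : ℝ) : Prop where
  mono : Monotone F
  lim_atBot : Tendsto F atBot (𝓝 0)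
  lim_atTop : Tendsto F atTop (𝓝 m)
  cont : Continuous A
  sub_mono : Monotone fun x => F x - A x
  sq_le : ∀ x z, x < z → (u z - u x) ^ 2 ≤ (z - x) * (A z - A x)

/-- The generalized inverse of `x ↦ x + F x`. -/
noncomputable def char (F : ℝ → ℝ) (ξ : ℝ) : ℝ := sSup {x : ℝ | x + F x < ξ}

namespace CumData

variable {u F A : ℝ → ℝ} {m : ℝ} (h : CumData u F A m)
include h

lemma nonneg (x : ℝ) : 0 ≤ F x := h.mono.le_of_tendsto h.lim_atBot x

lemma le_total (x : ℝ) : F x ≤ m := h.mono.ge_of_tendsto h.lim_atTop x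

lemma monoA : Monotone A := by
  intro x z hxz
  rcases hxz.eq_or_lt with rfl | hlt
  · exact le_rfl
  · have h1 := (sq_nonneg _).trans (h.sq_le x z hlt)
    have := nonneg_of_mul_nonneg_right h1 (sub_pos.2 hlt)
    linarith

lemma bddAbove (ξ : ℝ) : BddAbove {x : ℝ | x + F x < ξ} :=
  ⟨ξ, fun x hx => by have := h.nonneg x; simp only [mem_ofPred_eq] at hx; linarith⟩

lemma nonempty (ξ : ℝ) : {x : ℝ | x + F x < ξ}.Nonempty :=
  ⟨ξ - m - 1, by have := h.le_total (ξ - m - 1); simp only [mem_ofPred_eq]; linarith⟩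

lemma lt_of_lt_char {x ξ : ℝ} (hx : x < char F ξ) : x + F x < ξ := by
  obtain ⟨z, hz, hxz⟩ := exists_lt_of_lt_csSup (h.nonempty ξ) hx
  have := h.mono hxz.le
  simp only [mem_ofPred_eq] at hz
  linarith

lemma le_of_char_lt {x ξ : ℝ} (hx : char F ξ < x) : ξ ≤ x + F x := by
  by_contra! hlt
  exact absurd (le_csSup (h.bddAbove ξ) hlt) (not_le.2 hx)

lemma le_char {x ξ : ℝ} (hx : x + F x < ξ) : x ≤ char F ξ := le_csSup (h.bddAbove ξ) hx

lemma char_le {x ξ : ℝ} (hx : ξ ≤ x + F x) : char F ξ ≤ x := by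
  by_contra! hlt
  exact absurd (h.lt_of_lt_char hlt) (not_lt.2 hx)

lemma char_le_self (ξ : ℝ) : char F ξ ≤ ξ := h.char_le (by have := h.nonneg ξ; linarith)

lemma self_sub_le_char (ξ : ℝ) : ξ - m ≤ char F ξ := by
  apply le_of_forall_lt
  intro c hc
  refine lt_of_lt_of_le (b := (c + (ξ - m)) / 2) (by linarith) (h.le_char ?_)
  have := h.le_total ((c + (ξ - m)) / 2)
  linarith

lemma char_mono : Monotone (char F) := by
  intro ξ₁ ξ₂ hξ
  exact csSup_le_csSup (h.bddAbove ξ₂) (h.nonempty ξ₁) fun x hx => lt_of_lt_of_le hx hξ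

/-- `F` may jump at the two endpoints, so the bound on `x + F x` is available only strictly between
them. Replacing `F` by its continuous part `A`, legitimate because `F - A` is monotone, lets the
points tend to the endpoints. -/
lemma char_sub_add_le {ξ₁ ξ₂ : ℝ} (hξ : ξ₁ ≤ ξ₂) :
    (char F ξ₂ - char F ξ₁) + (A (char F ξ₂) - A (char F ξ₁)) ≤ ξ₂ - ξ₁ := by
  rcases (h.char_mono hξ).eq_or_lt with heq | hlt
  · rw [heq]; linarith
  set a := char F ξ₁ with ha
  set b := char F ξ₂ with hb
  have hA := h.cont
  have hcont : Continuous fun ε : ℝ => ((b - ε) - (a + ε)) + (A (b - ε) - A (a + ε)) := by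
    fun_prop
  have ht := (hcont.tendsto 0).mono_left (nhdsWithin_le_nhds (s := Ioi 0))
  simp only [sub_zero, add_zero] at ht
  refine le_of_tendsto ht ?_
  have hpos : 0 < (b - a) / 2 := by linarith
  filter_upwards [Ioo_mem_nhdsGT hpos] with ε hε
  have h1 := h.lt_of_lt_char (x := b - ε) (ξ := ξ₂) (by have := hε.1; linarith)
  have h2 := h.le_of_char_lt (x := a + ε) (ξ := ξ₁) (by have := hε.1; linarith)
  have h3 := h.sub_mono (a := a + ε) (b := b - ε) (by have := hε.2; linarith)
  simp only at h3
  linarith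

lemma tendsto_sub_char_atBot : Tendsto (fun ξ => ξ - char F ξ) atBot (𝓝 0) := by
  rw [Metric.tendsto_nhds]
  intro ε hε
  have h1 : Tendsto (fun ξ : ℝ => F (ξ + ε / 2)) atBot (𝓝 0) :=
    h.lim_atBot.comp (tendsto_atBot_add_const_right _ _ tendsto_id)
  filter_upwards [h1.eventually_lt_const (half_pos hε)] with ξ hξ
  have h2 := h.char_le_self ξ
  have h3 := h.le_of_char_lt (x := char F ξ + ε / 2) (ξ := ξ) (by linarith)
  have h4 := h.mono (a := char F ξ + ε / 2) (b := ξ + ε / 2) (by linarith)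
  rw [Real.dist_eq, sub_zero, abs_of_nonneg (by linarith)]
  linarith

lemma tendsto_sub_char_atTop : Tendsto (fun ξ => ξ - char F ξ) atTop (𝓝 m) := by
  rw [Metric.tendsto_nhds]
  intro ε hε
  have h1 : Tendsto (fun ξ : ℝ => F (ξ + (-m - ε / 2))) atTop (𝓝 m) :=
    h.lim_atTop.comp (tendsto_atTop_add_const_right _ _ tendsto_id)
  filter_upwards [h1.eventually_const_lt (show m - ε / 2 < m by linarith)] with ξ hξ
  have h2 := h.self_sub_le_char ξ
  have h3 := h.lt_of_lt_char (x := char F ξ - ε / 2) (ξ := ξ) (by linarith)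
  have h4 := h.mono (a := ξ + (-m - ε / 2)) (b := char F ξ - ε / 2) (by linarith)
  rw [Real.dist_eq, abs_of_nonpos (by linarith)]
  linarith

end CumData

/-! ### Lagrangian data and the conservative flow -/

/-- Lagrangian data with total energy `m`, normalized by `y + V = id`. -/
structure LagData (X : Lagrange) (m : ℝ) : Prop where
  y_mono : Monotone X.y
  V_mono : Monotone X.V
  y_add_V : ∀ ξ, X.y ξ + X.V ξ = ξ
  V_atBot : Tendsto X.V atBot (𝓝 0)
  V_atTop : Tendsto X.V atTop (𝓝 m)
  sq_le : ∀ ξ₁ ξ₂, ξ₁ ≤ ξ₂ →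
    (X.U ξ₂ - X.U ξ₁) ^ 2 ≤ (X.y ξ₂ - X.y ξ₁) * (X.V ξ₂ - X.V ξ₁)

lemma L_y (Z : Euler) (ξ : ℝ) : (L Z).y ξ = char (cum Z.μ) ξ := rfl

lemma L_U (Z : Euler) (ξ : ℝ) : (L Z).U ξ = Z.u (char (cum Z.μ) ξ) := rfl

lemma L_V (Z : Euler) (ξ : ℝ) : (L Z).V ξ = ξ - char (cum Z.μ) ξ := rfl

lemma CumData.lagData {Z : Euler} {A : ℝ → ℝ} {m : ℝ} (h : CumData Z.u (cum Z.μ) A m) :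
    LagData (L Z) m where
  y_mono := h.char_mono
  V_mono := by
    intro ξ₁ ξ₂ hξ
    have h1 := h.char_sub_add_le hξ
    have h2 := h.monoA (h.char_mono hξ)
    simp only [L_V]
    linarith
  y_add_V := fun ξ => by simp only [L_y, L_V]; ring
  V_atBot := h.tendsto_sub_char_atBot
  V_atTop := h.tendsto_sub_char_atTop
  sq_le := by
    intro ξ₁ ξ₂ hξ
    simp only [L_V, L_y, L_U]
    have h1 := h.char_sub_add_le hξ
    rcases (h.char_mono hξ).eq_or_lt with heq | hlt
    · simp [heq]
    · refine (h.sq_le _ _ hlt).trans ?_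
      apply mul_le_mul_of_nonneg_left _ (sub_pos.2 hlt).le
      linarith

/-- The solution of the conservative Lagrangian system. -/
noncomputable def freeFlow (m : ℝ) (X : Lagrange) (t : ℝ) : Lagrange where
  y := fun ξ => X.y ξ + t * X.U ξ + t ^ 2 / 2 * (X.V ξ / 2 - m / 4)
  U := fun ξ => X.U ξ + t * (X.V ξ / 2 - m / 4)
  V := X.V

lemma energyDensity_zero (X : Lagrange) (t : ℝ) : energyDensity 0 X t = deriv X.V := by
  ext η; simp [energyDensity]

lemma lipschitzWith_one_of_le {f : ℝ → ℝ}
    (hf : ∀ a b, a ≤ b → |f b - f a| ≤ b - a) : LipschitzWith 1 f := by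
  apply LipschitzWith.of_dist_le_mul
  intro a b
  simp only [NNReal.coe_one, one_mul, Real.dist_eq]
  rcases le_total a b with hab | hab
  · rw [abs_sub_comm, abs_sub_comm a b, abs_of_nonneg (sub_nonneg.2 hab)]
    exact hf a b hab
  · rw [abs_of_nonneg (sub_nonneg.2 hab)]
    exact hf b a hab

/-- A monotone Lipschitz function with a limit at `-∞` and at `∞` has an integrable derivative. -/
lemma integrable_deriv_of_monotone {f : ℝ → ℝ} {l m : ℝ} (hf : Monotone f)
    (hL : LipschitzWith 1 f) (hl : Tendsto f atBot (𝓝 l)) (hm : Tendsto f atTop (𝓝 m)) :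
    Integrable (deriv f) ∧ ∀ x, ∫ η in Iic x, deriv f η = f x - l := by
  have hac : ∀ a b, AbsolutelyContinuousOnInterval f a b := fun a b =>
    (hL.lipschitzOnWith (s := uIcc a b)).absolutelyContinuousOnInterval
  have hnn : ∀ x, 0 ≤ deriv f x := fun x => hf.deriv_nonneg
  have hint : Integrable (deriv f) := by
    -- The derivative is nonnegative and its integral over `[-n, n]` is an increment of `f`, at most
    -- `m - l`.
    refine integrable_of_intervalIntegral_norm_bounded (m - l)
      (fun n : ℕ => (hac (-(n : ℝ)) n).intervalIntegrable_deriv.1)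
      (tendsto_neg_atTop_atBot.comp tendsto_natCast_atTop_atTop) tendsto_natCast_atTop_atTop ?_
    refine Eventually.of_forall fun n => ?_
    simp only [Real.norm_of_nonneg (hnn _)]
    rw [(hac _ _).integral_deriv_eq_sub]
    have h1 := hf.ge_of_tendsto hm (n : ℝ)
    have h2 := hf.le_of_tendsto hl (-(n : ℝ))
    linarith
  refine ⟨hint, fun x => ?_⟩
  have h1 := intervalIntegral_tendsto_integral_Iic x hint.integrableOn tendsto_id
  refine tendsto_nhds_unique h1 ?_
  simp only [(hac _ _).integral_deriv_eq_sub]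
  exact hl.const_sub (f x)

namespace LagData

variable {X : Lagrange} {m : ℝ} (h : LagData X m)
include h

lemma V_nonneg (ξ : ℝ) : 0 ≤ X.V ξ := h.V_mono.le_of_tendsto h.V_atBot ξ

lemma V_le (ξ : ℝ) : X.V ξ ≤ m := h.V_mono.ge_of_tendsto h.V_atTop ξ

lemma V_sub_le {ξ₁ ξ₂ : ℝ} : X.V ξ₂ - X.V ξ₁ ≤ m := by
  have := h.V_nonneg ξ₁
  have := h.V_le ξ₂
  linarith

lemma lipschitz_y : LipschitzWith 1 X.y := lipschitzWith_one_of_le fun a b hab => by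
  have h1 := h.y_mono hab
  have h2 := h.V_mono hab
  have h3 := h.y_add_V a
  have h4 := h.y_add_V b
  rw [abs_of_nonneg (by linarith)]
  linarith

lemma lipschitz_V : LipschitzWith 1 X.V := lipschitzWith_one_of_le fun a b hab => by
  have h1 := h.y_mono hab
  have h2 := h.V_mono hab
  have h3 := h.y_add_V a
  have h4 := h.y_add_V b
  rw [abs_of_nonneg (by linarith)]
  linarith

lemma lipschitz_U : LipschitzWith 1 X.U := lipschitzWith_one_of_le fun a b hab => by
  have h1 := h.y_mono hab
  have h2 := h.V_mono hab
  have h3 := h.y_add_V a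
  have h4 := h.y_add_V b
  apply abs_le_of_sq_le_sq _ (by linarith)
  refine (h.sq_le a b hab).trans ?_
  rw [sq]
  apply mul_le_mul <;> linarith

lemma isLagrangianSolution : IsLagrangianSolution 0 X (freeFlow m X) where
  initial := by simp [freeFlow]
  integrable := fun t _ => by
    rw [energyDensity_zero]
    exact (integrable_deriv_of_monotone h.V_mono h.lipschitz_V h.V_atBot h.V_atTop).1
  V_eq := fun t _ ξ => by
    rw [energyDensity_zero,
      (integrable_deriv_of_monotone h.V_mono h.lipschitz_V h.V_atBot h.V_atTop).2 ξ, sub_zero]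
    rfl
  U_eq := ⟨fun _ => m, fun _ _ => h.V_atTop, fun t _ ξ => by
    refine ⟨by simp [freeFlow], ?_⟩
    simp only [freeFlow, intervalIntegral.integral_const, sub_zero, smul_eq_mul]
    ring⟩
  y_eq := fun t _ ξ => by
    have hc : Continuous fun r : ℝ => (freeFlow m X r).U ξ := by
      simp only [freeFlow]; fun_prop
    refine ⟨hc.intervalIntegrable _ _, ?_⟩
    simp only [freeFlow]
    rw [intervalIntegral.integral_add (by simp)
      (Continuous.intervalIntegrable (by fun_prop) _ _)]
    simp only [intervalIntegral.integral_const, intervalIntegral.integral_mul_const,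
      integral_id, smul_eq_mul]
    ring

/-- Uniqueness, needed because `S` picks an arbitrary solution: the equations determine `V`, then
`V_∞`, then `U`, then `y`. -/
lemma eq_freeFlow {Y : ℝ → Lagrange} (hY : IsLagrangianSolution 0 X Y) {t : ℝ} (ht : 0 ≤ t) :
    Y t = freeFlow m X t := by
  have hV : ∀ r, 0 ≤ r → (Y r).V = X.V := fun r hr => by
    ext ξ
    rw [hY.V_eq r hr, energyDensity_zero,
      (integrable_deriv_of_monotone h.V_mono h.lipschitz_V h.V_atBot h.V_atTop).2 ξ, sub_zero]
  obtain ⟨Vinf, hVinf, hU⟩ := hY.U_eq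
  have hm : ∀ r, 0 ≤ r → Vinf r = m := fun r hr =>
    tendsto_nhds_unique (hVinf r hr) (by rw [hV r hr]; exact h.V_atTop)
  have hUt : ∀ r, 0 ≤ r → (Y r).U = (freeFlow m X r).U := fun r hr => by
    ext ξ
    rw [(hU r hr ξ).2]
    have : ∫ w in (0 : ℝ)..r, ((1 / 2) * (Y w).V ξ - (1 / 4) * Vinf w)
        = ∫ _ in (0 : ℝ)..r, ((1 / 2) * X.V ξ - (1 / 4) * m) := by
      apply intervalIntegral.integral_congr
      intro w hw
      rw [uIcc_of_le hr] at hw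
      simp only [hV w hw.1, hm w hw.1]
    rw [this]
    simp only [freeFlow, intervalIntegral.integral_const, sub_zero, smul_eq_mul]
    ring
  have hyt : (Y t).y = (freeFlow m X t).y := by
    ext ξ
    rw [(hY.y_eq t ht ξ).2, (h.isLagrangianSolution.y_eq t ht ξ).2]
    congr 1
    apply intervalIntegral.integral_congr
    intro w hw
    rw [uIcc_of_le ht] at hw
    simp only [hUt w hw.1]
  have h1 := hV t ht
  have h2 := hUt t ht
  cases hYt : Y t
  rw [hYt] at h1 h2 hyt
  simp only at h1 h2 hyt
  rw [h1, h2, hyt]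
  rfl

lemma S_eq_freeFlow {t : ℝ} (ht : 0 ≤ t) : S 0 t X = freeFlow m X t := by
  have hex : ∃ Y : ℝ → Lagrange, IsLagrangianSolution 0 X Y := ⟨_, h.isLagrangianSolution⟩
  rw [S, dif_pos hex]
  exact h.eq_freeFlow hex.choose_spec ht

/-- The difference of the two sides is independent of `t`: both gain `t δU δV + (t²/4)(δV)²`. -/
lemma freeFlow_sq_le {t ξ₁ ξ₂ : ℝ} (hξ : ξ₁ ≤ ξ₂) :
    ((freeFlow m X t).U ξ₂ - (freeFlow m X t).U ξ₁) ^ 2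
      ≤ ((freeFlow m X t).y ξ₂ - (freeFlow m X t).y ξ₁) * (X.V ξ₂ - X.V ξ₁) := by
  have := h.sq_le ξ₁ ξ₂ hξ
  simp only [freeFlow]
  linear_combination this

/-- Spending only half of `δy` to absorb `t δU` by AM–GM leaves linear growth in `ξ`, which makes
`y(t)` onto. -/
lemma freeFlow_y_sub_ge (t : ℝ) {ξ₁ ξ₂ : ℝ} (hξ : ξ₁ ≤ ξ₂) :
    (ξ₂ - ξ₁ - m) / 2 - t ^ 2 * m / 4
      ≤ (freeFlow m X t).y ξ₂ - (freeFlow m X t).y ξ₁ := by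
  have h1 := h.y_mono hξ
  have h2 := h.V_mono hξ
  have h3 := h.y_add_V ξ₁
  have h4 := h.y_add_V ξ₂
  have h5 := h.V_sub_le (ξ₁ := ξ₁) (ξ₂ := ξ₂)
  have h6 : |t * (X.U ξ₂ - X.U ξ₁)|
      ≤ (X.y ξ₂ - X.y ξ₁) / 2 + t ^ 2 * (X.V ξ₂ - X.V ξ₁) / 2 := by
    have h7 : 0 ≤ t ^ 2 * (X.V ξ₂ - X.V ξ₁) := mul_nonneg (sq_nonneg t) (by linarith)
    apply abs_le_of_sq_le_sq _ (by linarith)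
    have h8 := mul_le_mul_of_nonneg_left (h.sq_le ξ₁ ξ₂ hξ) (sq_nonneg t)
    have h9 := sq_nonneg ((X.y ξ₂ - X.y ξ₁) / 2 - t ^ 2 * (X.V ξ₂ - X.V ξ₁) / 2)
    linear_combination h8 + h9
  have h10 := (abs_le.1 h6).1
  have h11 := mul_le_mul_of_nonneg_left h5 (sq_nonneg t)
  simp only [freeFlow]
  linarith

/-- AM–GM: `|t δU| ≤ |t| √(δy δV) ≤ δy + (t²/4) δV`, and the right side is exactly what accompanies
`t δU` in the increment of `y(t)`. -/
lemma freeFlow_y_mono (t : ℝ) : Monotone (freeFlow m X t).y := by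
  intro ξ₁ ξ₂ hξ
  have h1 := h.y_mono hξ
  have h2 := h.V_mono hξ
  have h6 : |t * (X.U ξ₂ - X.U ξ₁)|
      ≤ (X.y ξ₂ - X.y ξ₁) + t ^ 2 * (X.V ξ₂ - X.V ξ₁) / 4 := by
    have h7 : 0 ≤ t ^ 2 * (X.V ξ₂ - X.V ξ₁) := mul_nonneg (sq_nonneg t) (by linarith)
    apply abs_le_of_sq_le_sq _ (by linarith)
    have h8 := mul_le_mul_of_nonneg_left (h.sq_le ξ₁ ξ₂ hξ) (sq_nonneg t)
    have h9 := sq_nonneg ((X.y ξ₂ - X.y ξ₁) - t ^ 2 * (X.V ξ₂ - X.V ξ₁) / 4)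
    linear_combination h8 + h9
  have h10 := (abs_le.1 h6).1
  simp only [freeFlow]
  linarith

lemma freeFlow_y_surjective (t : ℝ) : Function.Surjective (freeFlow m X t).y := by
  have hy := h.lipschitz_y.continuous
  have hU := h.lipschitz_U.continuous
  have hV := h.lipschitz_V.continuous
  have hc : Continuous (freeFlow m X t).y := by
    simp only [freeFlow]; fun_prop
  refine hc.surjective ?_ ?_
  · have hlin : Tendsto (fun ξ : ℝ => (1 / 2) * ξ
        + ((freeFlow m X t).y 0 - m / 2 - t ^ 2 * m / 4)) atTop atTop :=
      tendsto_atTop_add_const_right _ _ (tendsto_id.const_mul_atTop (by norm_num))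
    refine tendsto_atTop_mono' _ ?_ hlin
    filter_upwards [eventually_ge_atTop 0] with ξ hξ
    have := h.freeFlow_y_sub_ge t hξ
    linarith
  · have hlin : Tendsto (fun ξ : ℝ => (1 / 2) * ξ
        + ((freeFlow m X t).y 0 + m / 2 + t ^ 2 * m / 4)) atBot atBot :=
      tendsto_atBot_add_const_right _ _ (tendsto_id.const_mul_atBot (by norm_num))
    refine tendsto_atBot_mono' _ ?_ hlin
    filter_upwards [eventually_le_atBot 0] with ξ hξ
    have := h.freeFlow_y_sub_ge t hξ
    linarith

lemma freeFlow_abs_U_sub_le (t ξ₁ ξ₂ : ℝ) :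
    |(freeFlow m X t).U ξ₁ - (freeFlow m X t).U ξ₂|
      ≤ √(m * |(freeFlow m X t).y ξ₁ - (freeFlow m X t).y ξ₂|) := by
  apply Real.abs_le_sqrt
  wlog hξ : ξ₁ ≤ ξ₂ generalizing ξ₁ ξ₂
  · rw [abs_sub_comm, ← neg_sub, neg_sq]
    exact this ξ₂ ξ₁ (le_of_not_ge hξ)
  have h1 := sub_nonneg.2 (h.freeFlow_y_mono t hξ)
  rw [abs_sub_comm, abs_of_nonneg h1, ← neg_sub, neg_sq, mul_comm]
  exact (h.freeFlow_sq_le hξ).trans (mul_le_mul_of_nonneg_left h.V_sub_le h1)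

/-- Uniform stability of the Eulerian profile in terms of the Lagrangian one. -/
lemma abs_M_u_sub_le {X' : Lagrange} (h' : LagData X' m) {t E B : ℝ}
    (hE : ∀ ξ, |(freeFlow m X t).y ξ - (freeFlow m X' t).y ξ| ≤ E)
    (hB : ∀ ξ, |(freeFlow m X t).U ξ - (freeFlow m X' t).U ξ| ≤ B) (x : ℝ) :
    |(M (freeFlow m X t)).u x - (M (freeFlow m X' t)).u x| ≤ √(m * E) + B := by
  simp only [M]
  set ξ := Function.invFun (freeFlow m X t).y x with hξ
  set η := Function.invFun (freeFlow m X' t).y x with hη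
  have h1 : (freeFlow m X t).y ξ = x :=
    Function.rightInverse_invFun (h.freeFlow_y_surjective t) x
  have h2 : (freeFlow m X' t).y η = x :=
    Function.rightInverse_invFun (h'.freeFlow_y_surjective t) x
  have hm : 0 ≤ m := (h.V_nonneg 0).trans (h.V_le 0)
  -- Both labels are mapped to `x`, so the spatial distance between `ξ` and `η` under one flow
  -- equals the difference of the two flows at `η`.
  have h3 : |(freeFlow m X t).y ξ - (freeFlow m X t).y η| ≤ E := by
    rw [h1, ← h2, abs_sub_comm]; exact hE η
  have h4 := h.freeFlow_abs_U_sub_le t ξ η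
  have h5 := Real.sqrt_le_sqrt (mul_le_mul_of_nonneg_left h3 hm)
  have h6 := hB η
  have h7 := abs_sub_le ((freeFlow m X t).U ξ) ((freeFlow m X t).U η) ((freeFlow m X' t).U η)
  linarith

end LagData

/-! ### Admissible data satisfy `CumData` -/

lemma MemE2.continuous {f : ℝ → ℝ} (hf : MemE2 f) : Continuous f := by
  obtain ⟨χp, χm, hχ, a, b, h⟩ := hf
  have h1 := h.1
  have h2 := hχ.smooth_p.continuous
  have h3 := hχ.smooth_m.continuous
  have : f = fun x => (f x - a * χp x - b * χm x) + a * χp x + b * χm x := by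
    ext x; ring
  rw [this]
  exact (h1.add (continuous_const.mul h2)).add (continuous_const.mul h3)

lemma acPart_le (μ : Measure ℝ) : acPart μ ≤ μ := Measure.withDensity_rnDeriv_le _ _

lemma acPart_absolutelyContinuous (μ : Measure ℝ) : acPart μ ≪ volume :=
  withDensity_absolutelyContinuous _ _

instance (μ : Measure ℝ) [IsFiniteMeasure μ] : IsFiniteMeasure (acPart μ) :=
  isFiniteMeasure_of_le μ (acPart_le μ)

lemma singularPart_add_acPart (μ : Measure ℝ) [IsFiniteMeasure μ] :
    μ.singularPart volume + acPart μ = μ :=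
  Measure.singularPart_add_rnDeriv μ volume

lemma cum_eq_add (μ : Measure ℝ) [IsFiniteMeasure μ] (x : ℝ) :
    cum μ x = cum (acPart μ) x + cum (μ.singularPart volume) x := by
  conv_lhs => rw [← singularPart_add_acPart μ]
  rw [cum_add, add_comm]

lemma continuous_cum (ν : Measure ℝ) [IsFiniteMeasure ν] [NullSingletonClass ν] : Continuous (cum ν) := by
  have hIco : ∀ a b : ℝ, ν.real (Ico a b) = ν.real (Ioc a b) := fun a b =>
    measureReal_congr Ico_ae_eq_Ioc
  have h : cum ν = fun x => cum ν 0 + ∫ _ in (0 : ℝ)..x, (1 : ℝ) ∂ν := by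
    ext x
    rw [intervalIntegral.integral_const', smul_eq_mul, mul_one, ← hIco, ← hIco]
    rcases le_total 0 x with hx | hx
    · rw [← cum_sub_cum ν hx, Ico_eq_empty (not_lt.2 hx), measureReal_empty]; ring
    · rw [← cum_sub_cum ν hx, Ico_eq_empty (not_lt.2 hx), measureReal_empty]; ring
  rw [h]
  exact continuous_const.add (intervalIntegral.continuous_primitive (fun a b => by simp) 0)

instance (μ : Measure ℝ) : NullSingletonClass (acPart μ) :=
  ⟨fun x => acPart_absolutelyContinuous μ (measure_singleton x)⟩

lemma MemD.cumData {Z : Euler} (hZ : MemD Z) :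
    CumData Z.u (cum Z.μ) (cum (acPart Z.μ)) (Z.μ.real univ) := by
  have := hZ.finite
  refine ⟨cum_mono _, tendsto_cum_atBot _, tendsto_cum_atTop _, continuous_cum _, ?_, ?_⟩
  · have h : (fun x => cum Z.μ x - cum (acPart Z.μ) x) = cum (Z.μ.singularPart volume) := by
      ext x; rw [cum_eq_add]; ring
    rw [h]
    exact cum_mono _
  · intro x z hxz
    obtain ⟨ux, hux, hac⟩ := hZ.ac_eq
    rw [cum_sub_cum _ hxz.le, measureReal_congr Ico_ae_eq_Ioc]
    exact hux.sq_sub_le hZ.u_mem.continuous hac hxz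

/-! ### The mesh and gluing across its cells -/

lemma grid_le_grid {Δx : ℝ} (hΔx : 0 < Δx) {k l : ℤ} (h : k ≤ l) : grid Δx k ≤ grid Δx l :=
  mul_le_mul_of_nonneg_right (by exact_mod_cast h) hΔx.le

lemma grid_lt_grid {Δx : ℝ} (hΔx : 0 < Δx) {k l : ℤ} (h : k < l) : grid Δx k < grid Δx l :=
  mul_lt_mul_of_pos_right (by exact_mod_cast h) hΔx

lemma grid_add_one (Δx : ℝ) (k : ℤ) : grid Δx (k + 1) = grid Δx k + Δx := by
  simp only [grid]; push_cast; ring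

lemma grid_add_two (Δx : ℝ) (k : ℤ) : grid Δx (k + 2) = grid Δx k + 2 * Δx := by
  simp only [grid]; push_cast; ring

lemma cell_mono {Δx : ℝ} (hΔx : 0 < Δx) : Monotone (cell Δx) := fun _ _ h =>
  sub_le_sub_right (Int.ceil_mono (div_le_div_of_nonneg_right h (by positivity))) 1

lemma cell_eq {Δx : ℝ} (hΔx : 0 < Δx) {x : ℝ} {j : ℤ} (h1 : grid Δx (2 * j) < x)
    (h2 : x ≤ grid Δx (2 * j + 2)) : cell Δx x = j := by
  have : ⌈x / (2 * Δx)⌉ = j + 1 := by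
    rw [Int.ceil_eq_iff, lt_div_iff₀ (by positivity), div_le_iff₀ (by positivity)]
    simp only [grid] at h1 h2
    push_cast at h1 h2 ⊢
    constructor <;> linarith
  rw [cell, this]; ring

lemma grid_cell_lt {Δx : ℝ} (hΔx : 0 < Δx) (x : ℝ) : grid Δx (2 * cell Δx x) < x := by
  have h := Int.ceil_lt_add_one (x / (2 * Δx))
  rw [← sub_lt_iff_lt_add, lt_div_iff₀ (by positivity)] at h
  simp only [grid, cell]
  push_cast
  linarith

lemma le_grid_cell {Δx : ℝ} (hΔx : 0 < Δx) (x : ℝ) : x ≤ grid Δx (2 * cell Δx x + 2) := by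
  have h := Int.le_ceil (x / (2 * Δx))
  rw [div_le_iff₀ (by positivity)] at h
  simp only [grid, cell]
  push_cast
  linarith

lemma exists_grid_mem_Ico {Δx : ℝ} (hΔx : 0 < Δx) (x : ℝ) :
    ∃ k : ℤ, grid Δx k ≤ x ∧ x < grid Δx (k + 1) := by
  refine ⟨⌊x / Δx⌋, ?_, ?_⟩
  · have h := Int.floor_le (x / Δx)
    rwa [le_div_iff₀ hΔx] at h
  · have h := Int.lt_floor_add_one (x / Δx)
    rw [div_lt_iff₀ hΔx] at h
    simp only [grid]; push_cast; exact h

lemma exists_grid_mem_Ioc {Δx : ℝ} (hΔx : 0 < Δx) (x : ℝ) :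
    ∃ k : ℤ, grid Δx k < x ∧ x ≤ grid Δx (k + 1) := by
  refine ⟨⌈x / Δx⌉ - 1, ?_, ?_⟩
  · have h := Int.ceil_lt_add_one (x / Δx)
    rw [← sub_lt_iff_lt_add, lt_div_iff₀ hΔx] at h
    simp only [grid]; push_cast; exact h
  · have h := Int.le_ceil (x / Δx)
    rw [div_le_iff₀ hΔx] at h
    simpa [grid] using h

lemma continuous_of_continuousOn_mesh {Δx : ℝ} (hΔx : 0 < Δx) {f : ℝ → ℝ}
    (hf : ∀ k : ℤ, ContinuousOn f (Icc (grid Δx k) (grid Δx (k + 1)))) : Continuous f := by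
  rw [continuous_iff_continuousAt]
  intro x
  rw [continuousAt_iff_continuous_left_right]
  constructor
  · obtain ⟨k, h1, h2⟩ := exists_grid_mem_Ioc hΔx x
    refine (hf k x ⟨h1.le, h2⟩).mono_of_mem_nhdsWithin ?_
    filter_upwards [Ioc_mem_nhdsLE h1] with z hz
    exact ⟨hz.1.le, hz.2.trans h2⟩
  · obtain ⟨k, h1, h2⟩ := exists_grid_mem_Ico hΔx x
    refine (hf k x ⟨h1, h2.le⟩).mono_of_mem_nhdsWithin ?_
    filter_upwards [Ico_mem_nhdsGE h2] with z hz
    exact ⟨h1.trans hz.1, hz.2.le⟩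

/-- The increment of `u` over `[a, b]` is controlled by the increment of the energy `A`. -/
def EnergyControl (u A : ℝ → ℝ) (a b : ℝ) : Prop :=
  a ≤ b ∧ A a ≤ A b ∧ (u b - u a) ^ 2 ≤ (b - a) * (A b - A a)

lemma EnergyControl.refl (u A : ℝ → ℝ) (a : ℝ) : EnergyControl u A a a := by
  simp [EnergyControl]

/-- The cross term `2 δu δu'` is at most the sum of the mixed products of lengths and energies, by
AM–GM. -/
lemma EnergyControl.trans {u A : ℝ → ℝ} {a b c : ℝ} (h1 : EnergyControl u A a b)
    (h2 : EnergyControl u A b c) : EnergyControl u A a c := by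
  obtain ⟨hab, hA, hu⟩ := h1
  obtain ⟨hbc, hA', hu'⟩ := h2
  refine ⟨hab.trans hbc, hA.trans hA', ?_⟩
  have p1 := mul_nonneg (sub_nonneg.2 hab) (sub_nonneg.2 hA')
  have p2 := mul_nonneg (sub_nonneg.2 hbc) (sub_nonneg.2 hA)
  have key : |2 * ((u b - u a) * (u c - u b))|
      ≤ (b - a) * (A c - A b) + (c - b) * (A b - A a) := by
    apply abs_le_of_sq_le_sq _ (add_nonneg p1 p2)
    have h3 := mul_le_mul hu hu' (sq_nonneg _)
      (mul_nonneg (sub_nonneg.2 hab) (sub_nonneg.2 hA))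
    have h4 := sq_nonneg ((b - a) * (A c - A b) - (c - b) * (A b - A a))
    linear_combination 4 * h3 + h4
  have := (abs_le.1 key).2
  linear_combination hu + hu' + this

/-- On a mesh, piecewise affine `u` with slope `c` and energy with slope `c ^ 2`
satisfy the energy control globally. -/
lemma EnergyControl.of_piecewise_affine {Δx : ℝ} (hΔx : 0 < Δx) {u A : ℝ → ℝ}
    (h : ∀ k : ℤ, ∃ c, ∀ x ∈ Icc (grid Δx k) (grid Δx (k + 1)),
      u x = u (grid Δx k) + c * (x - grid Δx k) ∧
      A x = A (grid Δx k) + c ^ 2 * (x - grid Δx k)) {x z : ℝ} (hxz : x ≤ z) :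
    EnergyControl u A x z := by
  have hloc : ∀ k : ℤ, ∀ a ∈ Icc (grid Δx k) (grid Δx (k + 1)),
      ∀ b ∈ Icc (grid Δx k) (grid Δx (k + 1)), a ≤ b → EnergyControl u A a b := by
    intro k a ha b hb hab
    obtain ⟨c, hc⟩ := h k
    obtain ⟨h1, h2⟩ := hc a ha
    obtain ⟨h3, h4⟩ := hc b hb
    refine ⟨hab, ?_, ?_⟩
    · rw [h2, h4]
      have := mul_le_mul_of_nonneg_left hab (sq_nonneg c)
      linarith
    · rw [h1, h2, h3, h4]
      apply le_of_eq; ring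
  have hle : ∀ k : ℤ, grid Δx k ≤ grid Δx (k + 1) := fun k =>
    grid_le_grid hΔx (by lia)
  have hgrid : ∀ k l : ℤ, k ≤ l → EnergyControl u A (grid Δx k) (grid Δx l) := by
    intro k l hkl
    induction l, hkl using Int.leInduction with
    | base => exact EnergyControl.refl u A _
    | succ l _ ih =>
      exact ih.trans (hloc l _ (left_mem_Icc.2 (hle l)) _ (right_mem_Icc.2 (hle l)) (hle l))
  obtain ⟨k, hk1, hk2⟩ := exists_grid_mem_Ico hΔx x
  obtain ⟨l, hl1, hl2⟩ := exists_grid_mem_Ico hΔx z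
  rcases lt_trichotomy k l with hkl | rfl | hkl
  · refine ((hloc k x ⟨hk1, hk2.le⟩ _ (right_mem_Icc.2 (hle k)) hk2.le).trans
      (hgrid (k + 1) l hkl)).trans ?_
    exact hloc l _ (left_mem_Icc.2 (hle l)) z ⟨hl1, hl2.le⟩ hl1
  · exact hloc k x ⟨hk1, hk2.le⟩ z ⟨hl1, hl2.le⟩ hxz
  · have := grid_le_grid hΔx (show l + 1 ≤ k from hkl)
    linarith

/-! ### The projection operator -/

section Projection

variable {Δx : ℝ} (hΔx : 0 < Δx) (s : ℤ → ℤˣ) {Z : Euler} (hZ : MemD Z)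
include hΔx hZ

/-- The radicand is nonnegative by the energy control over one cell, so the square root is not
truncated. -/
lemma q_sq (j : ℤ) :
    q Δx Z j ^ 2 = diffOp Δx (cum (acPart Z.μ)) j - diffOp Δx Z.u j ^ 2 := by
  apply Real.sq_sqrt
  have h := hZ.cumData.sq_le (grid Δx (2 * j)) (grid Δx (2 * j + 2))
    (grid_lt_grid hΔx (by lia))
  rw [grid_add_two] at h
  simp only [diffOp, sub_nonneg, grid_add_two]
  rw [div_pow, div_le_div_iff₀ (by positivity) (by positivity)]
  nlinarith

/-- An even node belongs to the cell on its left, so the right-half formula of cell `j - 1` applies.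
The energies match because the squares of the slopes `Du ∓ s q` average to `(Du)² + q² = DF_ac`. -/
lemma projU_projFac_grid_even (j : ℤ) :
    projU Δx s Z (grid Δx (2 * j)) = Z.u (grid Δx (2 * j)) ∧
    projFac Δx s Z (grid Δx (2 * j)) = cum (acPart Z.μ) (grid Δx (2 * j)) := by
  have e : 2 * (j - 1) + 2 = 2 * j := by ring
  have hc : cell Δx (grid Δx (2 * j)) = j - 1 :=
    cell_eq hΔx (grid_lt_grid hΔx (by lia)) (by rw [e])
  have hn : ¬ grid Δx (2 * j) ≤ grid Δx (2 * (j - 1) + 1) :=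
    not_le.2 (grid_lt_grid hΔx (by lia))
  have hq := q_sq hΔx hZ (j - 1)
  have hs : (((s (j - 1) : ℤˣ) : ℤ) : ℝ) ^ 2 = 1 := by
    rcases Int.units_eq_one_or (s (j - 1)) with h | h <;> simp [h]
  have hg : grid Δx (2 * j) - grid Δx (2 * (j - 1) + 1) = Δx := by
    simp only [grid]; push_cast; ring
  constructor
  · simp only [projU, hc, hn, if_false, e]; ring
  · simp only [projFac, hc, hn, if_false, hg]
    have hD : diffOp Δx (cum (acPart Z.μ)) (j - 1) * (2 * Δx)
        = cum (acPart Z.μ) (grid Δx (2 * j)) - cum (acPart Z.μ) (grid Δx (2 * (j - 1))) := by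
      simp only [diffOp, e]; field_simp
    rw [e]
    linear_combination Δx * hq + (1 / 2) * hD + Δx * q Δx Z (j - 1) ^ 2 * hs

lemma projU_projFac_left (j : ℤ) {x : ℝ}
    (hx : x ∈ Icc (grid Δx (2 * j)) (grid Δx (2 * j + 1))) :
    projU Δx s Z x = Z.u (grid Δx (2 * j))
      + (diffOp Δx Z.u j - ((s j : ℤ) : ℝ) * q Δx Z j) * (x - grid Δx (2 * j)) ∧
    projFac Δx s Z x = cum (acPart Z.μ) (grid Δx (2 * j))
      + (diffOp Δx Z.u j - ((s j : ℤ) : ℝ) * q Δx Z j) ^ 2 * (x - grid Δx (2 * j)) := by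
  rcases hx.1.eq_or_lt with rfl | hlt
  · simpa using projU_projFac_grid_even hΔx s hZ j
  · have hc : cell Δx x = j :=
      cell_eq hΔx hlt (hx.2.trans (grid_le_grid hΔx (by lia)))
    simp only [projU, projFac, hc, hx.2, if_true, and_self]

/-- Rewriting the formula from the midpoint shows that the two half-cell branches agree there, so
the projection is continuous in `u` and in `F_ac`. -/
lemma projU_projFac_right (j : ℤ) {x : ℝ}
    (hx : x ∈ Icc (grid Δx (2 * j + 1)) (grid Δx (2 * j + 2))) :
    projU Δx s Z x = projU Δx s Z (grid Δx (2 * j + 1))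
      + (diffOp Δx Z.u j + ((s j : ℤ) : ℝ) * q Δx Z j) * (x - grid Δx (2 * j + 1)) ∧
    projFac Δx s Z x = projFac Δx s Z (grid Δx (2 * j + 1))
      + (diffOp Δx Z.u j + ((s j : ℤ) : ℝ) * q Δx Z j) ^ 2 * (x - grid Δx (2 * j + 1)) := by
  rcases hx.1.eq_or_lt with rfl | hlt
  · simp
  · have hc : cell Δx x = j :=
      cell_eq hΔx ((grid_lt_grid hΔx (by lia)).trans hlt) hx.2
    have hm := projU_projFac_left hΔx s hZ j (right_mem_Icc.2 (grid_le_grid hΔx (by lia)))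
    have hq := q_sq hΔx hZ j
    have hs : (((s j : ℤˣ) : ℤ) : ℝ) ^ 2 = 1 := by
      rcases Int.units_eq_one_or (s j) with h | h <;> simp [h]
    have hD : diffOp Δx (cum (acPart Z.μ)) j * (2 * Δx)
        = cum (acPart Z.μ) (grid Δx (2 * j + 2)) - cum (acPart Z.μ) (grid Δx (2 * j)) := by
      simp only [diffOp]; field_simp
    have hD' : diffOp Δx Z.u j * (2 * Δx)
        = Z.u (grid Δx (2 * j + 2)) - Z.u (grid Δx (2 * j)) := by
      simp only [diffOp]; field_simp
    rw [hm.1, hm.2]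
    simp only [projU, projFac, hc, not_le.2 hlt, if_false]
    have hg1 : grid Δx (2 * j + 1) = grid Δx (2 * j) + Δx := grid_add_one _ _
    have hg2 : grid Δx (2 * j + 2) = grid Δx (2 * j) + 2 * Δx := grid_add_two _ _
    constructor
    · rw [hg1]
      rw [hg2] at hD' ⊢
      linear_combination -hD'
    · rw [hg1]
      linear_combination -(1 / 2) * hD - Δx * hq - Δx * q Δx Z j ^ 2 * hs

lemma proj_piecewise_affine (k : ℤ) :
    ∃ c, ∀ x ∈ Icc (grid Δx k) (grid Δx (k + 1)),
      projU Δx s Z x = projU Δx s Z (grid Δx k) + c * (x - grid Δx k) ∧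
      projFac Δx s Z x = projFac Δx s Z (grid Δx k) + c ^ 2 * (x - grid Δx k) := by
  rcases Int.even_or_odd' k with ⟨j, rfl | rfl⟩
  · refine ⟨diffOp Δx Z.u j - ((s j : ℤ) : ℝ) * q Δx Z j, fun x hx => ?_⟩
    rw [(projU_projFac_grid_even hΔx s hZ j).1, (projU_projFac_grid_even hΔx s hZ j).2]
    exact projU_projFac_left hΔx s hZ j hx
  · refine ⟨diffOp Δx Z.u j + ((s j : ℤ) : ℝ) * q Δx Z j, fun x hx =>
      projU_projFac_right hΔx s hZ j ?_⟩
    rwa [add_assoc] at hx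

lemma proj_energyControl {x z : ℝ} (hxz : x ≤ z) :
    EnergyControl (projU Δx s Z) (projFac Δx s Z) x z :=
  EnergyControl.of_piecewise_affine hΔx (proj_piecewise_affine hΔx s hZ) hxz

lemma continuous_projFac : Continuous (projFac Δx s Z) := by
  refine continuous_of_continuousOn_mesh hΔx fun k => ?_
  obtain ⟨c, hc⟩ := proj_piecewise_affine hΔx s hZ k
  exact ContinuousOn.congr (by fun_prop) fun x hx => (hc x hx).2

lemma projFac_mono : Monotone (projFac Δx s Z) := fun _ _ h =>
  (proj_energyControl hΔx s hZ h).2.1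

lemma projFac_le (x : ℝ) : projFac Δx s Z x ≤ (acPart Z.μ).real univ := by
  have := hZ.finite
  have h := projFac_mono hΔx s hZ (le_grid_cell hΔx x)
  have e : 2 * cell Δx x + 2 = 2 * (cell Δx x + 1) := by ring
  rw [e, (projU_projFac_grid_even hΔx s hZ _).2] at h
  exact h.trans (cum_le _ _)

lemma projFac_nonneg (x : ℝ) : 0 ≤ projFac Δx s Z x := by
  have := hZ.finite
  have h := projFac_mono hΔx s hZ (grid_cell_lt hΔx x).le
  rw [(projU_projFac_grid_even hΔx s hZ _).2] at h
  exact (cum_nonneg _ _).trans h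

lemma projFsing_mono : Monotone (projFsing Δx Z) := by
  have := hZ.finite
  intro x z h
  refine cum_mono _ (grid_le_grid hΔx ?_)
  have := cell_mono hΔx h
  lia

lemma projF_mono : Monotone fun x => projFac Δx s Z x + projFsing Δx Z x :=
  (projFac_mono hΔx s hZ).add (projFsing_mono hΔx hZ)

lemma projF_grid_even (j : ℤ) :
    projFac Δx s Z (grid Δx (2 * j)) + projFsing Δx Z (grid Δx (2 * j))
      = cum Z.μ (grid Δx (2 * j)) := by
  have := hZ.finite
  have e : 2 * (j - 1) + 2 = 2 * j := by ring
  have hc : cell Δx (grid Δx (2 * j)) = j - 1 :=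
    cell_eq hΔx (grid_lt_grid hΔx (by lia)) (by rw [e])
  rw [(projU_projFac_grid_even hΔx s hZ j).2, cum_eq_add Z.μ, projFsing, hc, e]

lemma le_projF (x : ℝ) : cum Z.μ (x - 2 * Δx) ≤ projFac Δx s Z x + projFsing Δx Z x := by
  have := hZ.finite
  have h := projF_mono hΔx s hZ (grid_cell_lt hΔx x).le
  simp only [projF_grid_even hΔx s hZ] at h
  refine (cum_mono _ ?_).trans h
  have := le_grid_cell hΔx x
  rw [grid_add_two] at this
  linarith

lemma projF_le (x : ℝ) : projFac Δx s Z x + projFsing Δx Z x ≤ cum Z.μ (x + 2 * Δx) := by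
  have := hZ.finite
  have h := projF_mono hΔx s hZ (le_grid_cell hΔx x)
  have e : 2 * cell Δx x + 2 = 2 * (cell Δx x + 1) := by ring
  simp only [e, projF_grid_even hΔx s hZ] at h
  refine h.trans (cum_mono _ ?_)
  rw [← e, grid_add_two]
  have := grid_cell_lt hΔx x
  linarith

lemma tendsto_projF_atBot :
    Tendsto (fun x => projFac Δx s Z x + projFsing Δx Z x) atBot (𝓝 0) := by
  have := hZ.finite
  exact tendsto_of_tendsto_of_tendsto_of_le_of_le
    ((tendsto_cum_atBot Z.μ).comp (tendsto_atBot_add_const_right _ (-(2 * Δx)) tendsto_id))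
    ((tendsto_cum_atBot Z.μ).comp (tendsto_atBot_add_const_right _ (2 * Δx) tendsto_id))
    (le_projF hΔx s hZ) (projF_le hΔx s hZ)

lemma tendsto_projF_atTop :
    Tendsto (fun x => projFac Δx s Z x + projFsing Δx Z x) atTop (𝓝 (Z.μ.real univ)) := by
  have := hZ.finite
  exact tendsto_of_tendsto_of_tendsto_of_le_of_le
    ((tendsto_cum_atTop Z.μ).comp (tendsto_atTop_add_const_right _ (-(2 * Δx)) tendsto_id))
    ((tendsto_cum_atTop Z.μ).comp (tendsto_atTop_add_const_right _ (2 * Δx) tendsto_id))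
    (le_projF hΔx s hZ) (projF_le hΔx s hZ)

lemma projF_leftContinuous (x : ℝ) :
    ContinuousWithinAt (fun x => projFac Δx s Z x + projFsing Δx Z x) (Iic x) x := by
  refine (continuous_projFac hΔx s hZ).continuousWithinAt.add ?_
  refine (continuousWithinAt_const (b := projFsing Δx Z x)).congr_of_eventuallyEq ?_ rfl
  filter_upwards [Ioc_mem_nhdsLE (grid_cell_lt hΔx x)] with z hz
  simp only [projFsing]
  rw [cell_eq hΔx hz.1 (hz.2.trans (le_grid_cell hΔx x))]

lemma cum_P : cum (P Δx s Z).μ = fun x => projFac Δx s Z x + projFsing Δx Z x :=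
  cum_measureOfCum (exists_cum_eq (projF_mono hΔx s hZ) (projF_leftContinuous hΔx s hZ)
    (tendsto_projF_atBot hΔx s hZ) (tendsto_projF_atTop hΔx s hZ))

/-- `projFac` serves directly as the continuous part; it need not be identified with the cumulative
function of the absolutely continuous part of the projected measure. -/
lemma cumData_P :
    CumData (P Δx s Z).u (cum (P Δx s Z).μ) (projFac Δx s Z) (Z.μ.real univ) := by
  rw [cum_P hΔx s hZ]
  refine ⟨projF_mono hΔx s hZ, tendsto_projF_atBot hΔx s hZ, tendsto_projF_atTop hΔx s hZ,
    continuous_projFac hΔx s hZ, ?_, fun x z h => (proj_energyControl hΔx s hZ h.le).2.2⟩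
  simpa using projFsing_mono hΔx hZ

/-- The characteristics of the data and of its projection start in the same cell. -/
lemma exists_common_cell (ξ : ℝ) : ∃ j : ℤ,
    (L Z).y ξ ∈ Icc (grid Δx (2 * j)) (grid Δx (2 * j + 2)) ∧
    (L (P Δx s Z)).y ξ ∈ Icc (grid Δx (2 * j)) (grid Δx (2 * j + 2)) := by
  have h := hZ.cumData
  have h' := cumData_P hΔx s hZ
  have heq : ∀ j : ℤ, cum (P Δx s Z).μ (grid Δx (2 * j)) = cum Z.μ (grid Δx (2 * j)) := by
    intro j
    rw [cum_P hΔx s hZ]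
    exact projF_grid_even hΔx s hZ j
  have main : ∀ j : ℤ, grid Δx (2 * j) + cum Z.μ (grid Δx (2 * j)) < ξ →
      ξ ≤ grid Δx (2 * (j + 1)) + cum Z.μ (grid Δx (2 * (j + 1))) →
      (L Z).y ξ ∈ Icc (grid Δx (2 * j)) (grid Δx (2 * j + 2)) ∧
      (L (P Δx s Z)).y ξ ∈ Icc (grid Δx (2 * j)) (grid Δx (2 * j + 2)) := by
    intro j h1 h2
    have e : 2 * j + 2 = 2 * (j + 1) := by ring
    simp only [L_y, e]
    refine ⟨⟨h.le_char h1, h.char_le h2⟩, ⟨h'.le_char ?_, h'.char_le ?_⟩⟩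
    · rwa [heq]
    · rwa [heq]
  set j := cell Δx (char (cum Z.μ) ξ) with hj
  have hlow := h.lt_of_lt_char (grid_cell_lt hΔx (char (cum Z.μ) ξ))
  -- The cell of `y(ξ)` works unless `F` jumps at its right node and `ξ` lies beyond the value of `x
  -- + F(x)` there. Then `y(ξ)` is that node, and the next cell serves.
  by_cases hup : ξ ≤ grid Δx (2 * (j + 1)) + cum Z.μ (grid Δx (2 * (j + 1)))
  · exact ⟨j, main j hlow hup⟩
  · refine ⟨j + 1, main (j + 1) (not_le.1 hup) (h.le_of_char_lt ?_)⟩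
    exact (le_grid_cell hΔx _).trans_lt (grid_lt_grid hΔx (by lia))

lemma abs_L_y_sub_le (ξ : ℝ) : |(L Z).y ξ - (L (P Δx s Z)).y ξ| ≤ 2 * Δx := by
  obtain ⟨j, h1, h2⟩ := exists_common_cell hΔx s hZ ξ
  rw [grid_add_two] at h1 h2
  rw [abs_le]
  constructor <;> linarith [h1.1, h1.2, h2.1, h2.2]

lemma abs_L_U_sub_le (ξ : ℝ) :
    |(L Z).U ξ - (L (P Δx s Z)).U ξ| ≤ 2 * √(2 * Δx * (acPart Z.μ).real univ) := by
  have := hZ.finite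
  obtain ⟨j, h1, h2⟩ := exists_common_cell hΔx s hZ ξ
  rw [grid_add_two] at h1 h2
  have key : ∀ {u F A : ℝ → ℝ} {m x : ℝ}, CumData u F A m →
      x ∈ Icc (grid Δx (2 * j)) (grid Δx (2 * j) + 2 * Δx) →
      0 ≤ A (grid Δx (2 * j)) → A x ≤ (acPart Z.μ).real univ →
      |u x - u (grid Δx (2 * j))| ≤ √(2 * Δx * (acPart Z.μ).real univ) := by
    intro u F A m x h hx hA hA'
    apply Real.abs_le_sqrt
    rcases hx.1.eq_or_lt with heq | hlt
    · rw [← heq, sub_self, zero_pow two_ne_zero]; positivity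
    · refine (h.sq_le _ _ hlt).trans ?_
      have := h.monoA hlt.le
      apply mul_le_mul <;> linarith [hx.2]
  have k1 := key hZ.cumData h1 (cum_nonneg _ _) (cum_le _ _)
  have k2 := key (cumData_P hΔx s hZ) h2 (projFac_nonneg hΔx s hZ _) (projFac_le hΔx s hZ _)
  have e : (P Δx s Z).u (grid Δx (2 * j)) = Z.u (grid Δx (2 * j)) :=
    (projU_projFac_grid_even hΔx s hZ j).1
  rw [e, abs_sub_comm] at k2
  have k3 := abs_sub_le (Z.u ((L Z).y ξ)) (Z.u (grid Δx (2 * j)))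
    ((P Δx s Z).u ((L (P Δx s Z)).y ξ))
  have e1 : (L Z).U ξ = Z.u ((L Z).y ξ) := rfl
  have e2 : (L (P Δx s Z)).U ξ = (P Δx s Z).u ((L (P Δx s Z)).y ξ) := rfl
  rw [e1, e2]
  linarith

end Projection

/-! ### Final estimates -/

lemma sqrt_energy_bound {m a t δ : ℝ} (hm : 0 ≤ m) (ha : 0 ≤ a) (ham : a ≤ m) (ht : 0 ≤ t)
    (hδ : 0 ≤ δ) :
    √(m * ((1 + 2 * √2) * a ^ (1 / 2 : ℝ) * t * δ ^ (1 / 2 : ℝ) + (2 + (1 / 2) * t ^ 2) * δ))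
        + ((1 + 2 * √2) * a ^ (1 / 2 : ℝ) * δ ^ (1 / 2 : ℝ) + t * δ)
      ≤ √(1 + 2 * √2) * m ^ (3 / 4 : ℝ) * t ^ (1 / 2 : ℝ) * δ ^ (1 / 4 : ℝ)
        + (1 + 2 * √2 + √(2 + (1 / 2) * t ^ 2)) * m ^ (1 / 2 : ℝ) * δ ^ (1 / 2 : ℝ)
        + t * δ := by
  have h2 : 0 ≤ √2 := Real.sqrt_nonneg 2
  have hC : 0 ≤ 1 + 2 * √2 := by linarith
  have hK : 0 ≤ 2 + (1 / 2) * t ^ 2 := by positivity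
  have ham' : a ^ (1 / 2 : ℝ) ≤ m ^ (1 / 2 : ℝ) := Real.rpow_le_rpow ha ham (by norm_num)
  have hm1 : (m ^ (3 / 4 : ℝ)) ^ 2 = m * m ^ (1 / 2 : ℝ) := by
    rw [← Real.rpow_natCast, ← Real.rpow_mul hm]
    have e : (3 / 4 : ℝ) * (2 : ℕ) = 1 + 1 / 2 := by norm_num
    rw [e, Real.rpow_add_of_nonneg hm (by norm_num) (by norm_num), Real.rpow_one]
  have hδ1 : (δ ^ (1 / 4 : ℝ)) ^ 2 = δ ^ (1 / 2 : ℝ) := by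
    rw [← Real.rpow_natCast, ← Real.rpow_mul hδ]
    norm_num
  have hhalf : ∀ x : ℝ, 0 ≤ x → (x ^ (1 / 2 : ℝ)) ^ 2 = x := fun x hx => by
    rw [← Real.sqrt_eq_rpow, Real.sq_sqrt hx]
  have hm0 := Real.rpow_nonneg hm (1 / 2)
  have hm3 := Real.rpow_nonneg hm (3 / 4)
  have ht0 := Real.rpow_nonneg ht (1 / 2)
  have hδ0 := Real.rpow_nonneg hδ (1 / 2)
  have hδ4 := Real.rpow_nonneg hδ (1 / 4)
  have hX : 0 ≤ √(1 + 2 * √2) * m ^ (3 / 4 : ℝ) * t ^ (1 / 2 : ℝ) * δ ^ (1 / 4 : ℝ) := by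
    positivity
  have hY : 0 ≤ √(2 + (1 / 2) * t ^ 2) * m ^ (1 / 2 : ℝ) * δ ^ (1 / 2 : ℝ) := by positivity
  have hX2 : (√(1 + 2 * √2) * m ^ (3 / 4 : ℝ) * t ^ (1 / 2 : ℝ) * δ ^ (1 / 4 : ℝ)) ^ 2
      = (1 + 2 * √2) * (m * m ^ (1 / 2 : ℝ)) * t * δ ^ (1 / 2 : ℝ) := by
    rw [mul_pow, mul_pow, mul_pow, Real.sq_sqrt hC, hm1, hhalf t ht, hδ1]
  have hY2 : (√(2 + (1 / 2) * t ^ 2) * m ^ (1 / 2 : ℝ) * δ ^ (1 / 2 : ℝ)) ^ 2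
      = (2 + (1 / 2) * t ^ 2) * m * δ := by
    rw [mul_pow, mul_pow, Real.sq_sqrt hK, hhalf m hm, hhalf δ hδ]
  have hmain : √(m * ((1 + 2 * √2) * a ^ (1 / 2 : ℝ) * t * δ ^ (1 / 2 : ℝ)
        + (2 + (1 / 2) * t ^ 2) * δ))
      ≤ √(1 + 2 * √2) * m ^ (3 / 4 : ℝ) * t ^ (1 / 2 : ℝ) * δ ^ (1 / 4 : ℝ)
        + √(2 + (1 / 2) * t ^ 2) * m ^ (1 / 2 : ℝ) * δ ^ (1 / 2 : ℝ) := by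
    -- With `X` and `Y` the two terms on the right, `X² + Y²` already dominates the radicand once
    -- `a` is replaced by `m`; the cross term `2XY` is dropped.
    apply Real.sqrt_le_iff.2 ⟨add_nonneg hX hY, ?_⟩
    have h3 : m * ((1 + 2 * √2) * t * δ ^ (1 / 2 : ℝ)) * a ^ (1 / 2 : ℝ)
        ≤ m * ((1 + 2 * √2) * t * δ ^ (1 / 2 : ℝ)) * m ^ (1 / 2 : ℝ) :=
      mul_le_mul_of_nonneg_left ham' (by positivity)
    have h4 := mul_nonneg hX hY
    rw [add_sq, hX2, hY2]
    linarith
  have hB : (1 + 2 * √2) * a ^ (1 / 2 : ℝ) * δ ^ (1 / 2 : ℝ)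
      ≤ (1 + 2 * √2) * m ^ (1 / 2 : ℝ) * δ ^ (1 / 2 : ℝ) := by gcongr
  linarith

end HunterSaxton

theorem lemma5p1 (Z : HunterSaxton.Euler) (hZ : HunterSaxton.MemD Z)
    (Δx : ℝ) (hΔx : 0 < Δx) (s : ℤ → ℤˣ) (t : ℝ) (ht : 0 ≤ t) :
    (∀ ξ : ℝ,
      |(HunterSaxton.S 0 t (HunterSaxton.L Z)).U ξ
          - (HunterSaxton.S 0 t (HunterSaxton.L (HunterSaxton.P Δx s Z))).U ξ|
        ≤ (1 + 2 * √2) * (HunterSaxton.acPart Z.μ).real Set.univ ^ (1 / 2 : ℝ) * Δx ^ (1 / 2 : ℝ)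
          + t * Δx) ∧
    (∀ ξ : ℝ,
      |(HunterSaxton.S 0 t (HunterSaxton.L Z)).y ξ
          - (HunterSaxton.S 0 t (HunterSaxton.L (HunterSaxton.P Δx s Z))).y ξ|
        ≤ (1 + 2 * √2) * (HunterSaxton.acPart Z.μ).real Set.univ ^ (1 / 2 : ℝ) * t
            * Δx ^ (1 / 2 : ℝ)
          + (2 + (1 / 2) * t ^ 2) * Δx) ∧
    (∀ x : ℝ,
      |(HunterSaxton.T 0 t Z).u x - (HunterSaxton.T 0 t (HunterSaxton.P Δx s Z)).u x|
        ≤ √(1 + 2 * √2) * Z.μ.real Set.univ ^ (3 / 4 : ℝ) * t ^ (1 / 2 : ℝ) * Δx ^ (1 / 4 : ℝ)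
          + (1 + 2 * √2 + √(2 + (1 / 2) * t ^ 2)) * Z.μ.real Set.univ ^ (1 / 2 : ℝ)
            * Δx ^ (1 / 2 : ℝ)
          + t * Δx) := by
  have hfin := hZ.finite
  have hX := hZ.cumData.lagData
  have hX' := (HunterSaxton.cumData_P hΔx s hZ).lagData
  set a : ℝ := (HunterSaxton.acPart Z.μ).real Set.univ with ha
  have ha0 : 0 ≤ a := measureReal_nonneg
  have ham : a ≤ Z.μ.real Set.univ :=
    ENNReal.toReal_mono (measure_ne_top _ _) (HunterSaxton.acPart_le Z.μ Set.univ)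
  have hU₀ : ∀ ξ, |(HunterSaxton.L Z).U ξ - (HunterSaxton.L (HunterSaxton.P Δx s Z)).U ξ|
      ≤ (1 + 2 * √2) * a ^ (1 / 2 : ℝ) * Δx ^ (1 / 2 : ℝ) := by
    intro ξ
    refine (HunterSaxton.abs_L_U_sub_le hΔx s hZ ξ).trans ?_
    rw [Real.sqrt_mul (by positivity), Real.sqrt_mul zero_le_two, ← Real.sqrt_eq_rpow,
      ← Real.sqrt_eq_rpow]
    -- The estimate yields the factor `2√2`; the additional `1` in the stated constant is slack.
    have : 0 ≤ √a * √Δx := by positivity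
    linarith
  have hy₀ := HunterSaxton.abs_L_y_sub_le hΔx s hZ
  have hV₀ : ∀ ξ, |(HunterSaxton.L Z).V ξ - (HunterSaxton.L (HunterSaxton.P Δx s Z)).V ξ|
      ≤ 2 * Δx := by
    intro ξ
    have h1 := hX.y_add_V ξ
    have h2 := hX'.y_add_V ξ
    have h3 := abs_le.1 (hy₀ ξ)
    rw [abs_le]
    constructor <;> linarith
  have hU : ∀ ξ, |(HunterSaxton.freeFlow (Z.μ.real Set.univ) (HunterSaxton.L Z) t).U ξ
      - (HunterSaxton.freeFlow (Z.μ.real Set.univ)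
          (HunterSaxton.L (HunterSaxton.P Δx s Z)) t).U ξ|
      ≤ (1 + 2 * √2) * a ^ (1 / 2 : ℝ) * Δx ^ (1 / 2 : ℝ) + t * Δx := by
    intro ξ
    obtain ⟨h1, h2⟩ := abs_le.1 (hU₀ ξ)
    obtain ⟨h3, h4⟩ := abs_le.1 (hV₀ ξ)
    -- The error `2Δx` of `V` enters with weight `t/2` and produces the term `t Δx`.
    have h5 := mul_le_mul_of_nonneg_left h3 ht
    have h6 := mul_le_mul_of_nonneg_left h4 ht
    simp only [HunterSaxton.freeFlow]
    rw [abs_le]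
    constructor <;> linarith
  have hy : ∀ ξ, |(HunterSaxton.freeFlow (Z.μ.real Set.univ) (HunterSaxton.L Z) t).y ξ
      - (HunterSaxton.freeFlow (Z.μ.real Set.univ)
          (HunterSaxton.L (HunterSaxton.P Δx s Z)) t).y ξ|
      ≤ (1 + 2 * √2) * a ^ (1 / 2 : ℝ) * t * Δx ^ (1 / 2 : ℝ)
        + (2 + (1 / 2) * t ^ 2) * Δx := by
    intro ξ
    obtain ⟨h1, h2⟩ := abs_le.1 (hU₀ ξ)
    obtain ⟨h3, h4⟩ := abs_le.1 (hV₀ ξ)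
    obtain ⟨h5, h6⟩ := abs_le.1 (hy₀ ξ)
    have h7 := mul_le_mul_of_nonneg_left h1 ht
    have h8 := mul_le_mul_of_nonneg_left h2 ht
    have h9 := mul_le_mul_of_nonneg_left h3 (sq_nonneg t)
    have h10 := mul_le_mul_of_nonneg_left h4 (sq_nonneg t)
    simp only [HunterSaxton.freeFlow]
    rw [abs_le]
    constructor <;> linarith
  simp only [HunterSaxton.T, hX.S_eq_freeFlow ht, hX'.S_eq_freeFlow ht]
  exact ⟨hU, hy, fun x => (hX.abs_M_u_sub_le hX' hy hU x).trans
    (HunterSaxton.sqrt_energy_bound measureReal_nonneg ha0 ham ht hΔx.le)⟩
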